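/- \textbf{Setting.} Write $\hat f(\xi)=\int_{\mathbb{R}^3}e^{-2\pi i x\cdot\xi}f(x)\,dx$ for the Fourier (Plancherel) transform on $\mathbb{R}^3$, and equip $3\times 3$ matrices with the Frobenius inner product. Let $$L^2_{st}=\left\{\nabla_{sym}u:\ u\in \dot H^1(\mathbb{R}^3;\mathbb{R}^3),\ \nabla\cdot u=0\right\}\subset L^2\left(\mathbb{R}^3;\mathbb{R}^{3\times 3}\right),\qquad (\nabla_{sym}u)_{jk}=\tfrac12\left(\partial_j u_k+\partial_k u_j\right),$$ and let $P_{st}$ be the orthogonal projection of $L^2(\mathbb{R}^3;\mathbb{R}^{3\times 3})$ onto the closed subspace $L^2_{st}$. For $\tau>0$ let $e^{\tau\Delta}f=G(\cdot,\tau)*f$ with the heat kernel $G(x,\tau)=(4\pi\tau)^{-3/2}\exp\left(-|x|^2/(4\tau)\right)$. Let $\|S\|_{\dot H^1}^2=\int_{\mathbb{R}^3}(2\pi|\xi|)^2|\hat S(\xi)|^2\,d\xi$. Let $0<T_{max}\le\infty$. A function $S\in C\left([0,T_{max});L^2_{st}\right)$ is a mild solution of the strain self-amplification model equation $\partial_t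 S-\Delta S+\frac23P_{st}(S^2)=0$ if for all $0<t<T_{max}$ $$S(t)=e^{t\Delta}S(0)-\frac23\int_0^t e^{\tau\Delta}P_{st}\left(S^2(t-\tau)\right)d\tau,$$ where $S^2$ is the pointwise matrix square, which lies in $L^1$, and $e^{\tau\Delta}P_{st}(S^2)$ means $P_{st}\left(e^{\tau\Delta}S^2\right)$ with $e^{\tau\Delta}S^2\in L^2$. \textbf{Proposition.} Let $S\in C\left([0,T_{max});L^2_{st}\right)$ be a mild solution of the strain self-amplification model equation. Then for all $0<t<T_{max}$ one has $\|S(t)\|_{\dot H^1}<\infty$, the functions $\mathrm{tr}\left(S(\cdot,t)^3\right)$ and $\det\left(S(\cdot,t)\right)$ are integrable on $\mathbb{R}^3$, the function $s\mapsto\|S(s)\|_{L^2}^2$ is differentiable at $t$, and $$\partial_t\|S(t)\|_{L^2}^2=-2\|S(t)\|_{\dot H^1}^2-\frac43\int_{\mathbb{R}^3}\mathrm{tr}\left(S(x,t)^3\right)dx=-2\|S(t)\|_{\dot H^1}^2-4\int_{\mathbb{R}^3}\det\left(S(x,t)\right)dx.$$ -/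

import Mathlib

open MeasureTheory
open scoped FourierTransform

noncomputable section

namespace StrainModel

/-- Physical (and frequency) space `ℝ³` with its Euclidean norm. -/
abbrev R3 : Type := EuclideanSpace ℝ (Fin 3)

/-- Real `3 × 3` matrices with the Frobenius norm and inner product `⟨A, B⟩ = ∑ A_jk B_jk`;
the entry `A_jk` is `A (j, k)`. -/
abbrev Mat3 : Type := EuclideanSpace ℝ (Fin 3 × Fin 3)

/-- Complex `3 × 3` matrices with the Frobenius norm. -/
abbrev CMat3 : Type := EuclideanSpace ℂ (Fin 3 × Fin 3)

/-- `L²(ℝ³; ℝ^{3×3})`. -/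
abbrev L2Mat : Type := Lp (α := R3) Mat3 2

/-- An element of `Mat3` as a matrix in the sense of Mathlib (for products, trace, determinant). -/
def toMatrix (A : Mat3) : Matrix (Fin 3) (Fin 3) ℝ := Matrix.of fun j k => A (j, k)

/-- The matrix square `A²`, again as an element of `Mat3`. -/
def matSq (A : Mat3) : Mat3 := WithLp.toLp 2 fun p => (toMatrix A * toMatrix A) p.1 p.2

/-- The entrywise inclusion of real matrices into complex matrices. -/
def complexify : Mat3 →L[ℝ] CMat3 :=
  LinearMap.toContinuousLinearMap
    { toFun := fun A => WithLp.toLp 2 fun p => (A p : ℂ)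
      map_add' := fun A B => by ext p; simp
      map_smul' := fun c A => by ext p; simp }

/-- The Fourier (Plancherel) transform `Ŝ` of `S ∈ L²(ℝ³; ℝ^{3×3})`, taken entrywise, with the
normalization `f̂(ξ) = ∫ e^{-2πi x·ξ} f(x) dx`. -/
def hat (S : L2Mat) : Lp (α := R3) CMat3 2 := 𝓕 (complexify.compLp S)

/-- `v = û` is the Fourier transform of a divergence free vector field `u ∈ Ḣ¹(ℝ³)`:
`2π|ξ| û ∈ L²` and `ξ · û(ξ) = 0` for almost every `ξ`. -/
structure IsDivFreeHdot1 (v : R3 → EuclideanSpace ℂ (Fin 3)) : Prop where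
  aestronglyMeasurable : AEStronglyMeasurable v volume
  memLp : MemLp (fun ξ : R3 => (2 * Real.pi * ‖ξ‖) • v ξ) 2 volume
  divFree : ∀ᵐ ξ : R3, ∑ j, (ξ j : ℂ) * v ξ j = 0

/-- `S = ∇_sym u`, written on the Fourier side with `v = û`:
`Ŝ_jk = ½ (2πi ξ_j û_k + 2πi ξ_k û_j)`. -/
def IsSymGrad (S : L2Mat) (v : R3 → EuclideanSpace ℂ (Fin 3)) : Prop :=
  ∀ᵐ ξ : R3, ∀ j k, hat S ξ (j, k) =
    (1 / 2) * (2 * Real.pi * Complex.I * ξ j * v ξ k + 2 * Real.pi * Complex.I * ξ k * v ξ j)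

theorem hat_add (S Q : L2Mat) : hat (S + Q) = hat S + hat Q := by
  have h : complexify.compLp (S + Q) = complexify.compLp S + complexify.compLp Q :=
    map_add (complexify.compLpL 2 (volume : Measure R3)) S Q
  unfold hat
  rw [h, FourierTransform.fourier_add]

theorem hat_smul (c : ℝ) (S : L2Mat) : hat (c • S) = (c : ℂ) • hat S := by
  have h : complexify.compLp (c • S) = (c : ℂ) • complexify.compLp S := by
    have h1 : complexify.compLp (c • S) = c • complexify.compLp S :=
      map_smul (complexify.compLpL 2 (volume : Measure R3)) c S
    rw [h1]
    ext1
    filter_upwards [Lp.coeFn_smul c (complexify.compLp S),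
      Lp.coeFn_smul (c : ℂ) (complexify.compLp S)] with x h2 h3
    rw [h2, h3]
    simp
  unfold hat
  rw [h, FourierTransform.fourier_smul]

/-- The constraint space `L²_st = {∇_sym u : u ∈ Ḣ¹, ∇ · u = 0}` of strain matrices, a subspace of
`L²(ℝ³; ℝ^{3×3})`. Its elements are symmetric and trace free, and `u` is determined by `S`, hence
real valued because `S` is. -/
def L2st : Submodule ℝ L2Mat where
  carrier := {S | ∃ v, IsDivFreeHdot1 v ∧ IsSymGrad S v}
  add_mem' := by
    rintro S Q ⟨v, hv, hS⟩ ⟨w, hw, hQ⟩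
    refine ⟨v + w, ⟨hv.1.add hw.1, ?_, ?_⟩, ?_⟩
    · refine (hv.2.add hw.2).ae_eq (Filter.Eventually.of_forall fun ξ => ?_)
      simp [smul_add]
    · filter_upwards [hv.3, hw.3] with ξ h1 h2
      simp [mul_add, Finset.sum_add_distrib, h1, h2]
    · unfold IsSymGrad at *
      rw [hat_add]
      filter_upwards [hS, hQ, Lp.coeFn_add (hat S) (hat Q)] with ξ h1 h2 h3 j k
      rw [h3]
      simp only [Pi.add_apply, PiLp.add_apply, h1, h2]
      ring
  zero_mem' := by
    refine ⟨0, ⟨aestronglyMeasurable_const, by simp, by simp⟩, ?_⟩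
    have h : hat 0 = 0 := by simpa using hat_smul 0 0
    unfold IsSymGrad
    rw [h]
    filter_upwards [Lp.coeFn_zero CMat3 2 (volume : Measure R3)] with ξ h1 j k
    rw [h1]
    simp
  smul_mem' := by
    rintro c S ⟨v, hv, hS⟩
    refine ⟨(c : ℂ) • v, ⟨hv.1.const_smul (c : ℂ), ?_, ?_⟩, ?_⟩
    · refine (hv.2.const_smul (c : ℂ)).ae_eq (Filter.Eventually.of_forall fun ξ => ?_)
      simp only [Pi.smul_apply]
      exact smul_comm _ _ _
    · filter_upwards [hv.3] with ξ h1
      have : ∑ j, (ξ j : ℂ) * ((c : ℂ) • v) ξ j = c * ∑ j, (ξ j : ℂ) * v ξ j := by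
        rw [Finset.mul_sum]
        exact Finset.sum_congr rfl fun j _ => by simp; ring
      rw [this, h1, mul_zero]
    · unfold IsSymGrad at *
      rw [hat_smul]
      filter_upwards [hS, Lp.coeFn_smul (c : ℂ) (hat S)] with ξ h1 h3 j k
      rw [h3]
      simp only [Pi.smul_apply, PiLp.smul_apply, h1, smul_eq_mul]
      ring

/-- `S ∈ L²_st` if and only if `tr S = 0` and `S = ∇_sym (-Δ)⁻¹ (-2 div S)`. -/
theorem mem_L2st_iff (S : L2Mat) :
    S ∈ L2st ↔ ∀ᵐ ξ : R3, (∑ j, hat S ξ (j, j) = 0) ∧ ∀ j k,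
      (‖ξ‖ ^ 2 : ℝ) * hat S ξ (j, k) =
        ∑ l, ((ξ j : ℂ) * ξ l * hat S ξ (l, k) + (ξ k : ℂ) * ξ l * hat S ξ (l, j)) := by
  constructor
  · rintro ⟨v, hv, hS⟩
    filter_upwards [hv.3, hS] with ξ h1 h2
    have hn : ((‖ξ‖ ^ 2 : ℝ) : ℂ) = ξ 0 ^ 2 + ξ 1 ^ 2 + ξ 2 ^ 2 := by
      rw [EuclideanSpace.real_norm_sq_eq]
      simp [Fin.sum_univ_three]
    simp only [Fin.sum_univ_three] at h1 ⊢
    refine ⟨?_, fun j k => ?_⟩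
    · simp only [h2]
      linear_combination (2 * Real.pi * Complex.I) * h1
    · simp only [h2, hn]
      linear_combination (-(2 * Real.pi * Complex.I * ξ j * ξ k)) * h1
  · intro h
    have hm : ∀ l k, AEMeasurable (fun ξ : R3 => hat S ξ (l, k)) volume := fun l k =>
      (EuclideanSpace.proj (𝕜 := ℂ) (l, k)).continuous.measurable.comp_aemeasurable
        (Lp.aestronglyMeasurable (hat S)).aemeasurable
    have hc : ∀ l, Measurable fun ξ : R3 => (ξ l : ℂ) := fun l =>
      (Complex.continuous_ofReal.comp (EuclideanSpace.proj (𝕜 := ℝ) l).continuous).measurable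
    let v : R3 → EuclideanSpace ℂ (Fin 3) := fun ξ => WithLp.toLp 2 fun k =>
      (-Complex.I / (Real.pi * (‖ξ‖ ^ 2 : ℝ))) * ∑ l, (ξ l : ℂ) * hat S ξ (l, k)
    have hvm : AEStronglyMeasurable v volume := by
      refine AEMeasurable.aestronglyMeasurable ?_
      refine (PiLp.continuous_toLp 2 _).measurable.comp_aemeasurable (aemeasurable_pi_iff.2 ?_)
      intro k
      refine AEMeasurable.mul (Measurable.aemeasurable (by fun_prop)) ?_
      exact Finset.aemeasurable_fun_sum _ fun l _ => (hc l).aemeasurable.mul (hm l k)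
    have hne : ∀ᵐ ξ : R3, ξ ≠ 0 := by
      simp [ae_iff, measure_singleton]
    have hpi : (Real.pi : ℂ) ≠ 0 := by exact_mod_cast Real.pi_ne_zero
    refine ⟨v, ⟨hvm, ?_, ?_⟩, ?_⟩
    · refine MemLp.of_le_mul (c := 18) (Lp.memLp (hat S))
        (AEStronglyMeasurable.smul (f := fun ξ : R3 => 2 * Real.pi * ‖ξ‖)
          (Continuous.aestronglyMeasurable (by fun_prop)) hvm) ?_
      filter_upwards [hne] with ξ hξ
      have hpos : 0 < ‖ξ‖ := norm_pos_iff.2 hξ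
      have hk : ∀ k, ‖((2 * Real.pi * ‖ξ‖) • v ξ) k‖ ≤ 6 * ‖hat S ξ‖ := by
        intro k
        have h1 : ‖∑ l, (ξ l : ℂ) * hat S ξ (l, k)‖ ≤ ∑ l : Fin 3, ‖ξ‖ * ‖hat S ξ‖ := by
          refine (norm_sum_le _ _).trans (Finset.sum_le_sum fun l _ => ?_)
          rw [norm_mul, Complex.norm_real]
          exact mul_le_mul (PiLp.norm_apply_le ξ l) (PiLp.norm_apply_le (hat S ξ) (l, k))
            (norm_nonneg _) (norm_nonneg _)
        simp only [Finset.sum_const, Finset.card_univ, Fintype.card_fin, nsmul_eq_mul] at h1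
        have h2 : ‖((2 * Real.pi * ‖ξ‖) • v ξ) k‖ =
            2 / ‖ξ‖ * ‖∑ l, (ξ l : ℂ) * hat S ξ (l, k)‖ := by
          simp only [v, PiLp.smul_apply, norm_smul, norm_mul, norm_div, norm_neg, Complex.norm_I,
            Complex.norm_real, Real.norm_eq_abs, abs_of_pos Real.pi_pos, abs_of_pos hpos, abs_pow,
            abs_two, abs_norm]
          field_simp
        rw [h2]
        calc 2 / ‖ξ‖ * ‖∑ l, (ξ l : ℂ) * hat S ξ (l, k)‖
            ≤ 2 / ‖ξ‖ * ((3 : ℕ) * (‖ξ‖ * ‖hat S ξ‖)) := by gcongr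
          _ = 6 * ‖hat S ξ‖ := by push_cast; field_simp; ring
      refine abs_le_of_sq_le_sq' ?_ (by positivity) |>.2
      rw [EuclideanSpace.norm_sq_eq]
      calc ∑ k, ‖((2 * Real.pi * ‖ξ‖) • v ξ) k‖ ^ 2 ≤ ∑ k : Fin 3, (6 * ‖hat S ξ‖) ^ 2 :=
            Finset.sum_le_sum fun k _ => by gcongr; exact hk k
        _ ≤ (18 * ‖hat S ξ‖) ^ 2 := by
            simp only [Finset.sum_const, Finset.card_univ, Fintype.card_fin, nsmul_eq_mul]
            push_cast
            nlinarith [sq_nonneg ‖hat S ξ‖]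
    · filter_upwards [h, hne] with ξ h1 hξ
      have hn : ((‖ξ‖ ^ 2 : ℝ) : ℂ) = ξ 0 ^ 2 + ξ 1 ^ 2 + ξ 2 ^ 2 := by
        rw [EuclideanSpace.real_norm_sq_eq]
        simp [Fin.sum_univ_three]
      obtain ⟨h0, h1⟩ := h1
      have a := h1 0 0
      have b := h1 1 1
      have c := h1 2 2
      simp only [Fin.sum_univ_three, v] at *
      linear_combination (-Complex.I / (Real.pi * (‖ξ‖ ^ 2 : ℝ))) *
        ((‖ξ‖ ^ 2 : ℝ) / 2 * h0 - a / 2 - b / 2 - c / 2)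
    · filter_upwards [h, hne] with ξ h1 hξ j k
      have hN : ((‖ξ‖ ^ 2 : ℝ) : ℂ) ≠ 0 := by
        exact_mod_cast pow_ne_zero 2 (norm_ne_zero_iff.2 hξ)
      have a := h1.2 j k
      refine mul_left_cancel₀ hN ?_
      rw [a]
      simp only [v, Fin.sum_univ_three]
      field_simp
      ring_nf
      simp only [Complex.I_sq]
      ring

theorem isClosed_L2st : IsClosed (L2st : Set L2Mat) := by
  refine IsSeqClosed.isClosed fun f S hf hS => ?_
  have hcont : Continuous hat := by
    exact (Lp.fourierTransformₗᵢ R3 CMat3).continuous.comp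
      (complexify.compLpL 2 (volume : Measure R3)).continuous
  have hlim := (hcont.tendsto S).comp hS
  obtain ⟨ns, -, hns⟩ := (tendstoInMeasure_of_tendsto_Lp hlim).exists_seq_tendsto_ae
  have hall := ae_all_iff.2 fun n => (mem_L2st_iff (f n)).1 (hf n)
  refine (mem_L2st_iff S).2 ?_
  filter_upwards [hns, hall] with ξ h1 h2
  have hp : ∀ p, Filter.Tendsto (fun n => hat (f (ns n)) ξ p) Filter.atTop
      (nhds (hat S ξ p)) := fun p =>
    ((EuclideanSpace.proj (𝕜 := ℂ) p).continuous.tendsto _).comp h1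
  refine ⟨?_, fun j k => ?_⟩
  · refine tendsto_nhds_unique (tendsto_finsetSum Finset.univ fun j _ => hp (j, j)) ?_
    simp only [fun n => (h2 (ns n)).1]
    exact tendsto_const_nhds
  · refine tendsto_nhds_unique ((hp (j, k)).const_mul _) ?_
    simp only [fun n => (h2 (ns n)).2 j k]
    exact tendsto_finsetSum Finset.univ fun l _ =>
      ((hp (l, k)).const_mul _).add ((hp (l, j)).const_mul _)

instance : L2st.HasOrthogonalProjection :=
  haveI : CompleteSpace L2st := isClosed_L2st.completeSpace_coe
  inferInstance

/-- `P_st`, the orthogonal projection of `L²` onto `L²_st`. -/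
def Pst : L2Mat →L[ℝ] L2Mat := L2st.starProjection

/-- The heat kernel `G(x, t) = (4πt)^{-3/2} exp(-|x|² / (4t))`, for `t > 0`. -/
def heatKernel (t : ℝ) (x : R3) : ℝ :=
  (4 * Real.pi * t) ^ (-(3 / 2) : ℝ) * Real.exp (-‖x‖ ^ 2 / (4 * t))

/-- `e^{tΔ} f = G(·, t) * f`, for `t > 0`. -/
def heat (t : ℝ) (f : R3 → Mat3) : R3 → Mat3 :=
  convolution (heatKernel t) f (ContinuousLinearMap.lsmul ℝ ℝ) volume

open scoped Classical in
/-- The element of `L²` represented by `f`. It is only used for `f = G(·, t) * g` with `t > 0` and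
`g ∈ L¹` or `g ∈ L²`, and then `f ∈ L²` by Young's inequality because `G(·, t) ∈ L¹ ∩ L²`. -/
def toL2 (f : R3 → Mat3) : L2Mat := if h : MemLp f 2 volume then h.toLp f else 0

/-- The square `S²` of a matrix field; it lies in `L¹` if `S ∈ L²`. -/
def sq (S : L2Mat) : R3 → Mat3 := fun x => matSq (S x)

/-- A mild solution `S ∈ C([0, T); L²_st)`, `0 < T ≤ ∞`, of the strain self-amplification model
equation `∂ₜS - ΔS + ⅔ P_st(S²) = 0`: for all `0 < t < T`,
`S(t) = e^{tΔ} S(0) - ⅔ ∫₀ᵗ e^{τΔ} P_st(S²(t - τ)) dτ`.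
As `S²(t - τ)` is only known to be in `L¹`, while `e^{τΔ}` maps `L¹` and `L²` into `L²` and commutes
with `P_st`, the integrand is read as `P_st (e^{τΔ} S²(t - τ))`; the integral is a Bochner integral
in `L²`. -/
structure IsMildSolution (T : EReal) (S : ℝ → L2Mat) : Prop where
  mem : ∀ t : ℝ, 0 ≤ t → (t : EReal) < T → S t ∈ L2st
  continuousOn : ContinuousOn S {t : ℝ | 0 ≤ t ∧ (t : EReal) < T}
  duhamel : ∀ t : ℝ, 0 < t → (t : EReal) < T →
    S t = toL2 (heat t (S 0)) -
      (2 / 3 : ℝ) • ∫ τ in (0 : ℝ)..t, Pst (toL2 (heat τ (sq (S (t - τ)))))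

/-- The integrand `(2π|ξ|)² |Ŝ(ξ)|²` of `‖S‖²_{Ḣ¹}`. -/
def hdot1Density (S : L2Mat) (ξ : R3) : ℝ := (2 * Real.pi * ‖ξ‖) ^ 2 * ‖hat S ξ‖ ^ 2

/-- `‖S‖²_{Ḣ¹} = ∫ (2π|ξ|)² |Ŝ(ξ)|² dξ`. -/
def hdot1NormSq (S : L2Mat) : ℝ := ∫ ξ : R3, hdot1Density S ξ

end StrainModel

end

/-! On the Fourier side `Pst` is multiplication by a matrix `symbol ξ` that is an orthogonal
projection for every `ξ ≠ 0` (`hat_Pst`). The mild equation therefore decouples into one Duhamel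
formula per frequency, whose right hand side is `profile S t ξ`. It is defined for all `t` and `ξ`
and solves `∂ₜp = -(2π|ξ|)² p - ⅔ forcing` for each fixed `ξ`, while `hat (S t)` agrees with it
almost everywhere. By Plancherel `‖S t‖²` is the integral of `‖profile S t ξ‖²`, so it suffices to
differentiate under that integral.

The domination comes from parabolic smoothing. If the profile is dominated, uniformly on `[a, b]`,
by a function that is square integrable with weight `(1 + |ξ|)^ρ`, then the forcing, a correlation
of two such functions, is `O((1 + |ξ|)^{-ρ})` (`integral_weight_nl_le`). Integrating against the
heat factor gains two powers of decay. In dimension three, 8/5 > 3/2 of them pay for square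
integrability, so each round raises `ρ` by 2/5. Starting from a bounded forcing, four rounds give `ρ
= 8/5` (`hasProfileBound`). This controls the `Ḣ¹` norm and makes `hat (S t)` integrable, hence `S
t` bounded and its square an `L²` field.

In the resulting derivative the projection moves onto `hat (S t)`, which it fixes, and Plancherel
turns the nonlinear term into the integral of `tr S³` (`integral_re_inner_symbol_nl`). For trace
free matrices `tr A³ = 3 det A`. -/

noncomputable section

namespace StrainModel

/-! ### Plancherel transform of Hilbert space valued functions, characterized by duality with
Schwartz functions -/

section FourierPair

set_option linter.unusedSectionVars false

open SchwartzMap RealInnerProductSpace ComplexConjugate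

variable {E : Type*} [NormedAddCommGroup E] [MeasurableSpace E] [BorelSpace E]
  [InnerProductSpace ℝ E] [FiniteDimensional ℝ E]
  {F : Type*} [NormedAddCommGroup F] [InnerProductSpace ℂ F] [CompleteSpace F]
  {F' : Type*} [NormedAddCommGroup F'] [InnerProductSpace ℂ F'] [CompleteSpace F']

/-- `f` and `g` are square integrable and `g` is the Plancherel transform of `f`. -/
structure IsFourierPair (f g : E → F) : Prop where
  memLp_left : MemLp f 2 volume
  memLp_right : MemLp g 2 volume
  weak : ∀ φ : 𝓢(E, ℂ), ∫ x, φ x • g x = ∫ x, 𝓕 φ x • f x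

theorem isFourierPair_Lp (f : Lp (α := E) F 2) : IsFourierPair f (𝓕 f : Lp (α := E) F 2) := by
  refine ⟨Lp.memLp f, Lp.memLp _, fun φ => ?_⟩
  have h := congrArg (fun T => T φ) (Lp.fourier_toTemperedDistribution_eq f)
  simpa [TemperedDistribution.fourier_apply] using h.symm

theorem Lp.toTemperedDistribution_inj {f g : Lp (α := E) F 2}
    (h : ∀ φ : 𝓢(E, ℂ), ∫ x, φ x • f x = ∫ x, φ x • g x) : f = g := by
  have hk := Lp.ker_toTemperedDistributionCLM_eq_bot (E := E) (F := F) (μ := volume) (p := 2)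
  refine LinearMap.ker_eq_bot.1 hk ?_
  ext φ
  simpa using h φ

namespace IsFourierPair

variable {f g f₁ g₁ f₂ g₂ : E → F}

theorem congr (h : IsFourierPair f g) (hf : f =ᵐ[volume] f₁) (hg : g =ᵐ[volume] g₁) :
    IsFourierPair f₁ g₁ := by
  refine ⟨h.1.ae_eq hf, h.2.ae_eq hg, fun φ => ?_⟩
  rw [← integral_congr_ae (hg.mono fun x hx => congrArg (φ x • ·) hx),
    ← integral_congr_ae (hf.mono fun x hx => congrArg (𝓕 φ x • ·) hx)]
  exact h.3 φ

theorem fourier_toLp (h : IsFourierPair f g) : 𝓕 (h.1.toLp f) = h.2.toLp g := by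
  refine Lp.toTemperedDistribution_inj fun φ => ?_
  rw [(isFourierPair_Lp _).weak φ, integral_congr_ae (h.2.coeFn_toLp.mono fun x hx =>
    congrArg (φ x • ·) hx), h.weak, integral_congr_ae (h.1.coeFn_toLp.mono fun x hx =>
    congrArg (𝓕 φ x • ·) hx)]

theorem right_unique (h₁ : IsFourierPair f g₁) (h₂ : IsFourierPair f g₂) : g₁ =ᵐ[volume] g₂ := by
  have h := h₁.fourier_toLp.symm.trans h₂.fourier_toLp
  exact (MemLp.toLp_eq_toLp_iff _ _).1 h

theorem left_unique (h₁ : IsFourierPair f₁ g) (h₂ : IsFourierPair f₂ g) : f₁ =ᵐ[volume] f₂ := by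
  have h := h₁.fourier_toLp.trans h₂.fourier_toLp.symm
  exact (MemLp.toLp_eq_toLp_iff _ _).1 ((Lp.fourierTransformₗᵢ E F).injective h)

theorem integral_inner (h₁ : IsFourierPair f₁ g₁) (h₂ : IsFourierPair f₂ g₂) :
    ∫ x, inner ℂ (f₁ x) (f₂ x) = ∫ x, inner ℂ (g₁ x) (g₂ x) := by
  have h := Lp.inner_fourier_eq (h₁.1.toLp f₁) (h₂.1.toLp f₂)
  rw [h₁.fourier_toLp, h₂.fourier_toLp, L2.inner_def, L2.inner_def] at h
  have e : ∀ {a b : E → F} (ha : MemLp a 2 volume) (hb : MemLp b 2 volume),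
      ∫ x, inner ℂ (ha.toLp a x) (hb.toLp b x) = ∫ x, inner ℂ (a x) (b x) := by
    intro a b ha hb
    refine integral_congr_ae ?_
    filter_upwards [ha.coeFn_toLp, hb.coeFn_toLp] with x h1 h2
    rw [h1, h2]
  rw [e, e] at h
  exact h.symm

theorem clm (h : IsFourierPair f g) (L : F →L[ℂ] F') :
    IsFourierPair (fun x => L (f x)) (fun x => L (g x)) := by
  refine ⟨L.comp_memLp' h.1, L.comp_memLp' h.2, fun φ => ?_⟩
  have key : ∀ (ψ : 𝓢(E, ℂ)) (u : E → F), MemLp u 2 volume →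
      ∫ x, ψ x • L (u x) = L (∫ x, ψ x • u x) := by
    intro ψ u hu
    rw [← ContinuousLinearMap.integral_comp_comm]
    · simp
    · exact memLp_one_iff_integrable.1 (hu.smul (ψ.memLp 2))
  rw [key _ _ h.2, h.3, ← key _ _ h.1]

/-- Translating the test function multiplies its transform by a character, which can be moved onto
`f`. With Parseval this expresses the transform of a product as a correlation, see `nl_apply_eq`. -/
theorem modulate (h : IsFourierPair f g) (a : E) :
    IsFourierPair (fun x => 𝐞 (-⟪x, a⟫) • f x) (fun x => g (x + a)) := by
  have hm : MemLp (fun x => 𝐞 (-⟪x, a⟫) • f x) 2 volume := by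
    refine h.1.of_le (AEStronglyMeasurable.smul (f := fun x : E => 𝐞 (-⟪x, a⟫))
      (Continuous.aestronglyMeasurable ?_) h.1.1) (by simp)
    exact Real.continuous_fourierChar.comp (by fun_prop)
  refine ⟨hm, h.2.comp_measurePreserving (measurePreserving_add_right volume a), fun φ => ?_⟩
  have e1 : ∫ x, φ x • g (x + a) = ∫ x, (φ.compSubConstCLM ℂ a) x • g x := by
    rw [← integral_add_right_eq_self (fun x => (φ.compSubConstCLM ℂ a) x • g x) a]
    simp
  rw [e1, h.weak]
  refine integral_congr_ae (Filter.Eventually.of_forall fun x => ?_)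
  have e2 : 𝓕 (φ.compSubConstCLM ℂ a) x = 𝐞 (-⟪x, a⟫) • 𝓕 φ x := by
    rw [SchwartzMap.fourier_coe, SchwartzMap.fourier_coe, Real.fourier_eq, Real.fourier_eq,
      ← integral_add_right_eq_self _ a, Circle.smul_def, ← integral_smul]
    congr with v
    simp only [compSubConstCLM_apply, add_sub_cancel_right, inner_add_left, neg_add,
      ← Circle.smul_def, smul_smul, AddChar.map_add_eq_mul, real_inner_comm x a, mul_comm]
  simp only [e2, smul_comm (𝓕 φ x), smul_assoc]

/-- The Plancherel transform of the conjugate is the reflected conjugate. -/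
theorem conj_neg (h : IsFourierPair f g) (C : F →L[ℝ] F)
    (hC : ∀ (c : ℂ) x, C (c • x) = conj c • C x) :
    IsFourierPair (fun x => C (f x)) (fun x => C (g (-x))) := by
  have hg : MemLp (fun x => g (-x)) 2 volume :=
    h.2.comp_measurePreserving (Measure.measurePreserving_neg volume)
  refine ⟨C.comp_memLp' h.1, C.comp_memLp' hg, fun φ => ?_⟩
  -- The test function `ψ x = conj (φ (-x))` has transform `conj (𝓕 φ)`, so applying the antilinear
  -- `C` to the weak identity for `ψ` gives the one required for `φ`.
  let ψ : 𝓢(E, ℂ) := SchwartzMap.postcompCLM (Complex.conjCLE : ℂ →L[ℝ] ℂ)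
    (SchwartzMap.compCLMOfContinuousLinearEquiv ℝ
      (LinearIsometryEquiv.neg ℝ (E := E)).toContinuousLinearEquiv φ)
  have hψ : ∀ x, ψ x = conj (φ (-x)) := fun x => rfl
  have hψF : ∀ x, 𝓕 ψ x = conj (𝓕 φ x) := by
    intro x
    rw [SchwartzMap.fourier_coe, SchwartzMap.fourier_coe, Real.fourier_eq, Real.fourier_eq,
      ← integral_neg_eq_self, ← integral_conj]
    congr with v
    simp [hψ, Circle.smul_def, ← Circle.coe_inv_eq_conj, AddChar.map_neg_eq_inv]
  have key : ∀ (χ : 𝓢(E, ℂ)) (u : E → F), MemLp u 2 volume →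
      ∫ x, conj (χ x) • C (u x) = C (∫ x, χ x • u x) := by
    intro χ u hu
    rw [← ContinuousLinearMap.integral_comp_comm]
    · simp [hC]
    · exact memLp_one_iff_integrable.1 (hu.smul (χ.memLp 2))
  have e1 : ∫ x, φ x • C (g (-x)) = ∫ x, conj (ψ x) • C (g x) := by
    rw [← integral_neg_eq_self]
    simp [hψ]
  rw [e1, key _ _ h.2, h.weak, ← key _ _ h.1]
  simp [hψF]

theorem integral_fourier_smul_eq_flip {φ : E → ℂ} {u : E → F} (hφ : Integrable φ)
    (hu : Integrable u) : ∫ x, 𝓕 φ x • u x = ∫ x, φ x • 𝓕 u x := by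
  simpa using! VectorFourier.integral_fourierIntegral_smul_eq_flip (L := innerₗ E)
    Real.continuous_fourierChar continuous_inner hφ hu

theorem continuous_fourier {u : E → F} (hu : Integrable u) : Continuous (𝓕 u) :=
  VectorFourier.fourierIntegral_continuous Real.continuous_fourierChar
    (by exact continuous_inner) hu

theorem norm_fourier_le (u : E → F) (ξ : E) : ‖𝓕 u ξ‖ ≤ ∫ x, ‖u x‖ :=
  VectorFourier.norm_fourierIntegral_le_integral_norm _ _ _ _ _

/-- Both functions are locally integrable and have the same integrals against smooth compactly
supported functions: one by the definition of a pair, the other by the multiplication formula. -/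
theorem ae_eq_fourier (h : IsFourierPair f g) (hf : Integrable f) : g =ᵐ[volume] 𝓕 f := by
  refine ae_eq_of_integral_contDiff_smul_eq (h.2.locallyIntegrable (by norm_num))
    (continuous_fourier hf).locallyIntegrable fun φ hφ hc => ?_
  have h1 : HasCompactSupport (Complex.ofRealCLM ∘ φ) := hc.comp_left rfl
  have h2 : ContDiff ℝ (↑(⊤ : ℕ∞)) (Complex.ofRealCLM ∘ φ) := by fun_prop
  have h3 := h.weak (h1.toSchwartzMap h2)
  have h4 := integral_fourier_smul_eq_flip (h1.toSchwartzMap h2).integrable hf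
  rw [← SchwartzMap.fourier_coe] at h4
  have := h3.trans h4
  simpa using this

theorem exists_right (hf : MemLp f 2 volume) : ∃ g, IsFourierPair f g :=
  ⟨_, (isFourierPair_Lp (hf.toLp f)).congr hf.coeFn_toLp (Filter.EventuallyEq.refl _ _)⟩

theorem exists_left (hg : MemLp g 2 volume) : ∃ f, IsFourierPair f g := by
  have h := isFourierPair_Lp (𝓕⁻ (hg.toLp g))
  rw [FourierTransform.fourier_fourierInv_eq] at h
  exact ⟨_, h.congr (Filter.EventuallyEq.refl _ _) hg.coeFn_toLp⟩

theorem of_integrable (hf : Integrable f) (hf2 : MemLp f 2 volume) : IsFourierPair f (𝓕 f) := by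
  obtain ⟨g, hg⟩ := exists_right hf2
  exact hg.congr (Filter.EventuallyEq.refl _ _) (hg.ae_eq_fourier hf)

/-- The inverse transform as a forward transform. -/
theorem symm_neg (h : IsFourierPair f g) : IsFourierPair g (fun x => f (-x)) := by
  have hf : MemLp (fun x => f (-x)) 2 volume :=
    h.1.comp_measurePreserving (Measure.measurePreserving_neg volume)
  refine ⟨h.2, hf, fun φ => ?_⟩
  rw [h.weak (𝓕 φ), ← integral_neg_eq_self]
  congr with x
  have : (𝓕 (𝓕 φ)) x = φ (-x) := by
    have h1 : (𝓕⁻ (𝓕 φ)) (-x) = φ (-x) := by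
      rw [FourierTransform.fourierInv_fourier_eq]
    rw [← h1, SchwartzMap.fourierInv_coe, Real.fourierInv_eq_fourier_neg, neg_neg]
    rfl
  simp [this]

theorem ae_eq_fourierInv (h : IsFourierPair f g) (hg : Integrable g) : f =ᵐ[volume] 𝓕⁻ g := by
  have h1 := h.symm_neg.ae_eq_fourier hg
  have h2 := (Measure.measurePreserving_neg (volume : Measure E)).quasiMeasurePreserving.ae_eq h1
  filter_upwards [h2] with x hx
  rw [Real.fourierInv_eq_fourier_neg]
  simpa using hx

theorem of_integrable_right (hg : Integrable g) (hg2 : MemLp g 2 volume) :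
    IsFourierPair (𝓕⁻ g) g := by
  obtain ⟨f, hf⟩ := exists_left hg2
  exact hf.congr (hf.ae_eq_fourierInv hg) (Filter.EventuallyEq.refl _ _)

theorem integral_norm_sq (h : IsFourierPair f g) : ∫ x, ‖f x‖ ^ 2 = ∫ x, ‖g x‖ ^ 2 := by
  have h1 := h.integral_inner h
  simp only [inner_self_eq_norm_sq_to_K] at h1
  have := congrArg Complex.re h1
  have e : ∀ u : E → F, ∫ x, ((‖u x‖ : ℂ)) ^ 2 = ((∫ x, ‖u x‖ ^ 2 : ℝ) : ℂ) := by
    intro u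
    rw [← integral_complex_ofReal]
    simp
  simpa [e] using this

end IsFourierPair

end FourierPair

/-! ### Real and complex matrices -/

section Matrices

open ComplexConjugate

@[simp]
theorem complexify_apply (A : Mat3) (p : Fin 3 × Fin 3) : complexify A p = (A p : ℂ) := rfl

@[simp]
theorem norm_complexify (A : Mat3) : ‖complexify A‖ = ‖A‖ := by
  simp [EuclideanSpace.norm_eq]

theorem inner_complexify (A B : Mat3) :
    inner ℂ (complexify A) (complexify B) = ((inner ℝ A B : ℝ) : ℂ) := by
  simp [PiLp.inner_apply]

/-- The entrywise real part. -/
def realPart : CMat3 →L[ℝ] Mat3 :=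
  LinearMap.toContinuousLinearMap
    { toFun := fun A => WithLp.toLp 2 fun p => (A p).re
      map_add' := fun A B => by ext p; simp
      map_smul' := fun c A => by ext p; simp }

@[simp]
theorem realPart_apply (A : CMat3) (p : Fin 3 × Fin 3) : realPart A p = (A p).re := rfl

@[simp]
theorem realPart_complexify (A : Mat3) : realPart (complexify A) = A := by
  ext p
  simp

/-- The entrywise complex conjugate. -/
def conjMat : CMat3 →L[ℝ] CMat3 :=
  LinearMap.toContinuousLinearMap
    { toFun := fun A => WithLp.toLp 2 fun p => conj (A p)
      map_add' := fun A B => by ext p; simp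
      map_smul' := fun c A => by ext p; simp }

@[simp]
theorem conjMat_apply (A : CMat3) (p : Fin 3 × Fin 3) : conjMat A p = conj (A p) := rfl

theorem conjMat_smul (c : ℂ) (A : CMat3) : conjMat (c • A) = conj c • conjMat A := by
  ext p
  simp

@[simp]
theorem conjMat_complexify (A : Mat3) : conjMat (complexify A) = complexify A := by
  ext p
  simp

theorem complexify_realPart (A : CMat3) :
    complexify (realPart A) = (1 / 2 : ℂ) • (A + conjMat A) := by
  ext p
  have h := Complex.add_conj (A p)
  simp only [complexify_apply, realPart_apply, PiLp.smul_apply, PiLp.add_apply, conjMat_apply, h]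
  simp

/-- The product of two matrices in `Mat3`. -/
def matMul (A B : Mat3) : Mat3 := WithLp.toLp 2 fun p => ∑ l, A (p.1, l) * B (l, p.2)

theorem matSq_eq (A : Mat3) : matSq A = matMul A A := by
  ext p
  simp [matSq, matMul, toMatrix, Matrix.mul_apply]

theorem norm_matMul_le (A B : Mat3) : ‖matMul A B‖ ≤ ‖A‖ * ‖B‖ := by
  refine abs_le_of_sq_le_sq' ?_ (by positivity) |>.2
  rw [mul_pow, EuclideanSpace.real_norm_sq_eq, EuclideanSpace.real_norm_sq_eq,
    EuclideanSpace.real_norm_sq_eq, Fintype.sum_prod_type, Fintype.sum_prod_type,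
    Fintype.sum_prod_type_right, Finset.sum_mul_sum]
  exact Finset.sum_le_sum fun j _ => Finset.sum_le_sum fun k _ =>
    Finset.sum_mul_sq_le_sq_mul_sq Finset.univ (fun l => A (j, l)) (fun l => B (l, k))

theorem norm_matSq_le (A : Mat3) : ‖matSq A‖ ≤ ‖A‖ ^ 2 := by
  rw [matSq_eq, pow_two]
  exact norm_matMul_le A A

theorem norm_matSq_sub_le (A B : Mat3) :
    ‖matSq A - matSq B‖ ≤ ‖A‖ * ‖A - B‖ + ‖A - B‖ * ‖B‖ := by
  have h : matSq A - matSq B = matMul A (A - B) + matMul (A - B) B := by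
    ext p
    simp only [matSq_eq, matMul, PiLp.sub_apply, PiLp.add_apply, mul_sub, sub_mul,
      Finset.sum_sub_distrib]
    ring
  rw [h]
  exact (norm_add_le _ _).trans (add_le_add (norm_matMul_le _ _) (norm_matMul_le _ _))

theorem continuous_matSq : Continuous matSq := by
  have : matSq = fun A => WithLp.toLp 2 fun p : Fin 3 × Fin 3 => ∑ l, A (p.1, l) * A (l, p.2) := by
    ext A p
    simp [matSq_eq, matMul]
  rw [this]
  fun_prop

theorem trace_pow_three_eq_inner {A : Mat3} (hA : ∀ j k, A (j, k) = A (k, j)) :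
    (toMatrix A ^ 3).trace = inner ℝ (matSq A) A := by
  rw [pow_succ, pow_two]
  simp only [Matrix.trace, Matrix.diag, Matrix.mul_apply, PiLp.inner_apply, matSq, toMatrix,
    Matrix.of_apply, Fintype.sum_prod_type]
  refine Finset.sum_congr rfl fun j _ => Finset.sum_congr rfl fun k _ => ?_
  rw [hA k j]
  simp [mul_comm]

/-- By Cayley–Hamilton a trace free `A` satisfies `A³ = -cA + (det A) I` for a scalar `c`; taking
traces leaves `3 det A`. The proof checks the same polynomial identity after eliminating one
diagonal entry. -/
theorem trace_pow_three_eq_det {A : Mat3} (hA : ∑ j, A (j, j) = 0) :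
    (toMatrix A ^ 3).trace = 3 * (toMatrix A).det := by
  rw [Matrix.det_fin_three, pow_succ, pow_two]
  simp only [Fin.sum_univ_three] at hA
  have h : A (2, 2) = - A (0, 0) - A (1, 1) := by linarith
  simp only [Matrix.trace, Matrix.diag, Matrix.mul_apply, toMatrix, Matrix.of_apply,
    Fin.sum_univ_three, h]
  ring

end Matrices

/-! ### The symbol of the projection onto `L2st` -/

section Symbol

open ComplexConjugate

/-- The pointwise constraint satisfied by the Fourier transform of an element of `L2st`. -/
def IsStrainAt (ξ : R3) (A : CMat3) : Prop :=
  (∑ j, A (j, j) = 0) ∧ ∀ j k, (‖ξ‖ ^ 2 : ℝ) * A (j, k) =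
    ∑ l, ((ξ j : ℂ) * ξ l * A (l, k) + (ξ k : ℂ) * ξ l * A (l, j))

/-- The symmetric part of `A` applied to `ξ`. -/
def symVec (ξ : R3) (A : CMat3) (k : Fin 3) : ℂ := ∑ l, (ξ l : ℂ) * (A (l, k) + A (k, l)) / 2

/-- The symbol of `P_st`. -/
def symbol (ξ : R3) : CMat3 →L[ℂ] CMat3 :=
  LinearMap.toContinuousLinearMap
    { toFun := fun A => WithLp.toLp 2 fun p =>
        -- With `b = symVec ξ A` and `b' = b - (ξ · b) ξ / |ξ|²`, this is `(ξ ⊗ b' + b' ⊗ ξ) /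
        -- |ξ|²`: the subtracted term removes the part of `b` along `ξ`, which enforces zero
        -- divergence. At `ξ = 0` the convention `0⁻¹ = 0` makes the symbol vanish.
        ((ξ p.1 : ℂ) * symVec ξ A p.2 + (ξ p.2 : ℂ) * symVec ξ A p.1) * ((‖ξ‖ ^ 2 : ℝ) : ℂ)⁻¹ -
          2 * (∑ k, (ξ k : ℂ) * symVec ξ A k) * ξ p.1 * ξ p.2 * (((‖ξ‖ ^ 2 : ℝ) : ℂ)⁻¹) ^ 2
      map_add' := fun A B => by
        ext p
        simp only [symVec, PiLp.add_apply, Fin.sum_univ_three]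
        ring
      map_smul' := fun c A => by
        ext p
        simp only [symVec, PiLp.smul_apply, smul_eq_mul, Fin.sum_univ_three, RingHom.id_apply]
        ring }

theorem symbol_apply (ξ : R3) (A : CMat3) (p : Fin 3 × Fin 3) : symbol ξ A p =
    ((ξ p.1 : ℂ) * symVec ξ A p.2 + (ξ p.2 : ℂ) * symVec ξ A p.1) * ((‖ξ‖ ^ 2 : ℝ) : ℂ)⁻¹ -
      2 * (∑ k, (ξ k : ℂ) * symVec ξ A k) * ξ p.1 * ξ p.2 * (((‖ξ‖ ^ 2 : ℝ) : ℂ)⁻¹) ^ 2 := rfl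

theorem ofReal_norm_sq (ξ : R3) : ((‖ξ‖ ^ 2 : ℝ) : ℂ) = ξ 0 ^ 2 + ξ 1 ^ 2 + ξ 2 ^ 2 := by
  rw [EuclideanSpace.real_norm_sq_eq]
  simp [Fin.sum_univ_three]

theorem ofReal_norm_sq_ne_zero {ξ : R3} (hξ : ξ ≠ 0) : ((‖ξ‖ ^ 2 : ℝ) : ℂ) ≠ 0 := by
  exact_mod_cast pow_ne_zero 2 (norm_ne_zero_iff.2 hξ)

theorem isStrainAt_symbol (ξ : R3) (A : CMat3) : IsStrainAt ξ (symbol ξ A) := by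
  by_cases hξ : ξ = 0
  · subst hξ
    simp [IsStrainAt, symbol_apply]
  have hN := ofReal_norm_sq_ne_zero hξ
  have hn := ofReal_norm_sq ξ
  simp only [IsStrainAt, symbol_apply]
  generalize ((‖ξ‖ ^ 2 : ℝ) : ℂ) = N at *
  generalize symVec ξ A = b
  refine ⟨?_, fun j k => ?_⟩
  · simp only [Fin.sum_univ_three]
    field_simp
    rw [hn]
    ring
  · simp only [Fin.sum_univ_three]
    field_simp
    rw [hn]
    ring

/-- The right hand side of the constraint is symmetric in `j, k`, so `A` is symmetric. Summing its
diagonal cases gives `|ξ|² tr A = 2 ξ · Aξ`, so `ξ · Aξ = 0` and the correction term of the symbol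
drops out. -/
theorem symbol_eq_self {ξ : R3} (hξ : ξ ≠ 0) {A : CMat3} (h : IsStrainAt ξ A) :
    symbol ξ A = A := by
  have hN := ofReal_norm_sq_ne_zero hξ
  obtain ⟨h0, h1⟩ := h
  have hsym : ∀ j k, A (j, k) = A (k, j) := by
    intro j k
    refine mul_left_cancel₀ hN ?_
    rw [h1, h1]
    simp only [Fin.sum_univ_three]
    ring
  have hb : ∀ k, symVec ξ A k = ∑ l, (ξ l : ℂ) * A (l, k) := by
    intro k
    simp only [symVec]
    refine Finset.sum_congr rfl fun l _ => ?_
    rw [hsym k l]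
    ring
  have hc : ∑ k, (ξ k : ℂ) * symVec ξ A k = 0 := by
    have a := h1 0 0
    have b := h1 1 1
    have c := h1 2 2
    simp only [hb, Fin.sum_univ_three] at *
    linear_combination (((‖ξ‖ ^ 2 : ℝ) : ℂ) * h0 - a - b - c) / 2
  ext ⟨j, k⟩
  rw [symbol_apply, hc]
  simp only [hb]
  refine mul_left_cancel₀ hN ?_
  rw [h1 j k]
  simp only [Fin.sum_univ_three]
  field_simp
  ring

theorem inner_symbol_left (ξ : R3) (A B : CMat3) :
    inner ℂ (symbol ξ A) B = inner ℂ A (symbol ξ B) := by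
  simp only [PiLp.inner_apply, symbol_apply, symVec, Fintype.sum_prod_type, Fin.sum_univ_three,
    RCLike.inner_apply, map_add, map_sub, map_mul, map_div₀, map_pow, map_inv₀, Complex.conj_ofReal,
    map_ofNat]
  generalize ((‖ξ‖ ^ 2 : ℝ) : ℂ)⁻¹ = N
  ring

theorem symbol_symbol (ξ : R3) (A : CMat3) : symbol ξ (symbol ξ A) = symbol ξ A := by
  by_cases hξ : ξ = 0
  · subst hξ
    ext p
    simp [symbol_apply]
  · exact symbol_eq_self hξ (isStrainAt_symbol ξ A)

/-- A self-adjoint idempotent `P` satisfies `‖PA‖² = ⟨A, PA⟩ ≤ ‖A‖ ‖PA‖`. -/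
theorem norm_symbol_le (ξ : R3) (A : CMat3) : ‖symbol ξ A‖ ≤ ‖A‖ := by
  have h : ‖symbol ξ A‖ ^ 2 ≤ ‖A‖ * ‖symbol ξ A‖ := by
    rw [← inner_self_eq_norm_sq (𝕜 := ℂ), inner_symbol_left, symbol_symbol]
    exact (RCLike.re_le_norm _).trans (norm_inner_le_norm _ _)
  by_contra! hlt
  nlinarith [norm_nonneg A]

/-- The coefficients are real and even in `ξ`. Hence the multiplier preserves Hermitian symmetry,
that is, it maps real fields to real fields. -/
theorem symbol_neg_conjMat (ξ : R3) (A : CMat3) :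
    symbol (-ξ) (conjMat A) = conjMat (symbol ξ A) := by
  ext p
  simp only [symbol_apply, symVec, conjMat_apply, Fin.sum_univ_three, map_add, map_sub, map_mul,
    map_div₀, map_pow, map_inv₀, Complex.conj_ofReal, map_ofNat, norm_neg, PiLp.neg_apply,
    Complex.ofReal_neg]
  ring

theorem measurable_symbol : Measurable fun q : R3 × CMat3 => symbol q.1 q.2 := by
  have h : (fun q : R3 × CMat3 => symbol q.1 q.2) = fun q => WithLp.toLp 2
      fun p => symbol q.1 q.2 p := rfl
  rw [h]
  refine (PiLp.continuous_toLp 2 _).measurable.comp (measurable_pi_iff.2 fun p => ?_)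
  simp only [symbol_apply, symVec]
  have h1 : ∀ l, Measurable fun q : R3 × CMat3 => (q.1 l : ℂ) := fun l =>
    Continuous.measurable (by fun_prop)
  have h2 : ∀ l, Measurable fun q : R3 × CMat3 => q.2 l := fun l =>
    Continuous.measurable (by fun_prop)
  have h3 : Measurable fun q : R3 × CMat3 => ((‖q.1‖ ^ 2 : ℝ) : ℂ)⁻¹ := by fun_prop
  fun_prop

end Symbol

/-! ### The Fourier transform of real matrix fields -/

section Hat

open ComplexConjugate

theorem isFourierPair_hat (S : L2Mat) : IsFourierPair (fun x => complexify (S x)) (hat S) :=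
  (isFourierPair_Lp (complexify.compLp S)).congr (complexify.coeFn_compLp S)
    (Filter.EventuallyEq.refl _ _)

theorem norm_sq_eq_integral {F : Type*} [NormedAddCommGroup F] [InnerProductSpace ℝ F]
    (Q : Lp (α := R3) F 2) : ‖Q‖ ^ 2 = ∫ x, ‖Q x‖ ^ 2 := by
  rw [← real_inner_self_eq_norm_sq, L2.inner_def]
  simp

theorem norm_sq_eq_integral_hat (Q : L2Mat) : ‖Q‖ ^ 2 = ∫ ξ, ‖hat Q ξ‖ ^ 2 := by
  rw [norm_sq_eq_integral, ← (isFourierPair_hat Q).integral_norm_sq]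
  simp

theorem norm_hat (Q : L2Mat) : ‖hat Q‖ = ‖Q‖ := by
  have h : ‖hat Q‖ ^ 2 = ‖Q‖ ^ 2 := by
    rw [norm_sq_eq_integral_hat, norm_sq_eq_integral (F := CMat3)]
  exact (sq_eq_sq₀ (norm_nonneg _) (norm_nonneg _)).1 h

theorem ofReal_integral_inner {f g : R3 → Mat3} {u v : R3 → CMat3}
    (hf : IsFourierPair (fun x => complexify (f x)) u)
    (hg : IsFourierPair (fun x => complexify (g x)) v) :
    ((∫ x, inner ℝ (f x) (g x) : ℝ) : ℂ) = ∫ ξ, inner ℂ (u ξ) (v ξ) := by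
  rw [← hf.integral_inner hg, ← integral_complex_ofReal]
  simp only [inner_complexify]

theorem memLp_of_pair {f : R3 → Mat3} {u : R3 → CMat3}
    (h : IsFourierPair (fun x => complexify (f x)) u) : MemLp f 2 volume := by
  have := realPart.comp_memLp' h.1
  simpa [Function.comp_def] using this

theorem toL2_coeFn {f : R3 → Mat3} (h : MemLp f 2 volume) : toL2 f =ᵐ[volume] f := by
  rw [toL2, dif_pos h]
  exact h.coeFn_toLp

/-- Belonging to a Fourier pair forces `f` into `L²`, so the default value `0` of `toL2` is never
met here. -/
theorem hat_toL2 {f : R3 → Mat3} {u : R3 → CMat3}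
    (h : IsFourierPair (fun x => complexify (f x)) u) : hat (toL2 f) =ᵐ[volume] u := by
  have h1 := isFourierPair_hat (toL2 f)
  refine h1.right_unique (h.congr ?_ (Filter.EventuallyEq.refl _ _))
  filter_upwards [toL2_coeFn (memLp_of_pair h)] with x hx
  rw [hx]

theorem hat_conj_neg (S : L2Mat) : hat S =ᵐ[volume] fun ξ => conjMat (hat S (-ξ)) := by
  have h := (isFourierPair_hat S).conj_neg conjMat conjMat_smul
  simp only [conjMat_complexify] at h
  exact (isFourierPair_hat S).right_unique h

theorem ae_ne_zero : ∀ᵐ ξ : R3, ξ ≠ 0 := by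
  simp [ae_iff, measure_singleton]

theorem mem_L2st_iff_isStrainAt (S : L2Mat) : S ∈ L2st ↔ ∀ᵐ ξ : R3, IsStrainAt ξ (hat S ξ) :=
  mem_L2st_iff S

/-- A square integrable field with Hermitian symmetry is the transform of a real field. -/
theorem exists_hat_eq {u : R3 → CMat3} (hu : MemLp u 2 volume)
    (hs : u =ᵐ[volume] fun ξ => conjMat (u (-ξ))) : ∃ S : L2Mat, hat S =ᵐ[volume] u := by
  obtain ⟨f, hf⟩ := IsFourierPair.exists_left hu
  have h1 := (hf.conj_neg conjMat conjMat_smul).congr (Filter.EventuallyEq.refl _ _) hs.symm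
  have h2 : f =ᵐ[volume] fun x => complexify (realPart (f x)) := by
    filter_upwards [hf.left_unique h1] with x hx
    rw [complexify_realPart, ← hx, ← two_smul ℂ, smul_smul]
    simp
  exact ⟨_, hat_toL2 (hf.congr h2 (Filter.EventuallyEq.refl _ _))⟩

theorem aestronglyMeasurable_symbol {u : R3 → CMat3} (hu : AEStronglyMeasurable u volume) :
    AEStronglyMeasurable (fun ξ => symbol ξ (u ξ)) volume :=
  (measurable_symbol.comp_aemeasurable
    (aemeasurable_id.prodMk hu.aemeasurable)).aestronglyMeasurable

/-- The multiplied transform is Hermitian, hence belongs to a real field `q`, and `q` lies in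
`L2st`. Since the symbol is self-adjoint and fixes strains, Parseval gives `f - q ⟂ L2st`. These two
properties characterize the orthogonal projection. -/
theorem hat_Pst (f : L2Mat) : hat (Pst f) =ᵐ[volume] fun ξ => symbol ξ (hat f ξ) := by
  have hu : MemLp (fun ξ => symbol ξ (hat f ξ)) 2 volume :=
    (Lp.memLp (hat f)).of_le (aestronglyMeasurable_symbol (Lp.aestronglyMeasurable _))
      (Filter.Eventually.of_forall fun ξ => norm_symbol_le _ _)
  have hs : (fun ξ => symbol ξ (hat f ξ)) =ᵐ[volume]
      fun ξ => conjMat (symbol (-ξ) (hat f (-ξ))) := by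
    filter_upwards [hat_conj_neg f] with ξ h
    rw [← symbol_neg_conjMat, neg_neg, ← h]
  obtain ⟨q, hq⟩ := exists_hat_eq hu hs
  have hmem : q ∈ L2st := by
    rw [mem_L2st_iff_isStrainAt]
    filter_upwards [hq] with ξ h
    rw [h]
    exact isStrainAt_symbol _ _
  have horth : f - q ∈ L2stᗮ := by
    refine (Submodule.mem_orthogonal _ _).2 fun s hs => ?_
    rw [inner_sub_right, sub_eq_zero, L2.inner_def, L2.inner_def]
    refine Complex.ofReal_injective ?_
    rw [ofReal_integral_inner (isFourierPair_hat s) (isFourierPair_hat f),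
      ofReal_integral_inner (isFourierPair_hat s) (isFourierPair_hat q)]
    refine integral_congr_ae ?_
    filter_upwards [hq, (mem_L2st_iff_isStrainAt s).1 hs, ae_ne_zero] with ξ h1 h2 h3
    rw [h1, ← inner_symbol_left, symbol_eq_self h3 h2]
  have : Pst f = q := Submodule.eq_starProjection_of_mem_orthogonal hmem horth
  rw [this]
  exact hq

/-- Symmetry and vanishing trace are linear relations with constant coefficients. They hold at
almost every frequency, and a linear functional of `S` whose transform vanishes is itself zero. -/
theorem ae_symm_of_mem_L2st {S : L2Mat} (hS : S ∈ L2st) :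
    ∀ᵐ x : R3, (∀ j k, S x (j, k) = S x (k, j)) ∧ ∑ j, S x (j, j) = 0 := by
  have hp := isFourierPair_hat S
  have hst := (mem_L2st_iff_isStrainAt S).1 hS
  have key : ∀ L : CMat3 →L[ℂ] ℂ, (∀ ξ A, ξ ≠ 0 → IsStrainAt ξ A → L A = 0) →
      ∀ᵐ x : R3, L (complexify (S x)) = 0 := by
    intro L hL
    have h0 : IsFourierPair (fun _ : R3 => (0 : ℂ)) (fun _ => 0) := by
      refine ⟨MemLp.zero', MemLp.zero', by simp⟩
    refine ((hp.clm L).congr (Filter.EventuallyEq.refl _ _) ?_).left_unique h0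
    filter_upwards [hst, ae_ne_zero] with ξ h1 h2
    exact hL ξ _ h2 h1
  have hsymm : ∀ j k, ∀ᵐ x : R3, S x (j, k) = S x (k, j) := by
    intro j k
    have := key (EuclideanSpace.proj (j, k) - EuclideanSpace.proj (k, j)) (by
      intro ξ A hξ hA
      simp only [sub_apply, PiLp.proj_apply, sub_eq_zero]
      refine mul_left_cancel₀ (ofReal_norm_sq_ne_zero hξ) ?_
      rw [hA.2, hA.2]
      exact Finset.sum_congr rfl fun l _ => add_comm _ _)
    filter_upwards [this] with x hx
    simp only [sub_apply, PiLp.proj_apply, sub_eq_zero,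
      complexify_apply] at hx
    exact_mod_cast hx
  have htr : ∀ᵐ x : R3, ∑ j, S x (j, j) = 0 := by
    have := key (∑ j, EuclideanSpace.proj (j, j)) (by
      intro ξ A hξ hA
      simpa using hA.1)
    filter_upwards [this] with x hx
    simp only [sum_apply, PiLp.proj_apply, complexify_apply] at hx
    exact_mod_cast hx
  filter_upwards [ae_all_iff.2 fun j => ae_all_iff.2 (hsymm j), htr] with x h1 h2
  exact ⟨h1, h2⟩

end Hat

/-! ### The nonlinearity -/

section Nonlinearity

/-- The Fourier transform of `S²`. -/
def nl (Q : L2Mat) : R3 → CMat3 := 𝓕 fun x => complexify (sq Q x)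

theorem aestronglyMeasurable_sq (Q : L2Mat) : AEStronglyMeasurable (sq Q) volume :=
  continuous_matSq.comp_aestronglyMeasurable (Lp.aestronglyMeasurable Q)

theorem integrable_norm_sq (Q : L2Mat) : Integrable fun x => ‖Q x‖ ^ 2 :=
  (memLp_two_iff_integrable_sq_norm (Lp.aestronglyMeasurable Q)).1 (Lp.memLp Q)

theorem integrable_sq (Q : L2Mat) : Integrable (sq Q) :=
  (integrable_norm_sq Q).mono' (aestronglyMeasurable_sq Q)
    (Filter.Eventually.of_forall fun _ => norm_matSq_le _)

theorem integral_norm_mul_norm_le (Q R : L2Mat) : ∫ x, ‖Q x‖ * ‖R x‖ ≤ ‖Q‖ * ‖R‖ := by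
  have h := integral_mul_norm_le_Lp_mul_Lq (μ := (volume : Measure R3)) (f := Q) (g := R)
    Real.HolderConjugate.two_two (by simpa using Lp.memLp Q) (by simpa using Lp.memLp R)
  simp only [Real.rpow_two, ← norm_sq_eq_integral] at h
  rwa [← Real.sqrt_eq_rpow, ← Real.sqrt_eq_rpow, Real.sqrt_sq (norm_nonneg _),
    Real.sqrt_sq (norm_nonneg _)] at h

theorem integrable_norm_mul_norm (Q R : L2Mat) : Integrable fun x => ‖Q x‖ * ‖R x‖ :=
  MemLp.integrable_mul (Lp.memLp Q).norm (Lp.memLp R).norm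

theorem norm_nl_le (Q : L2Mat) (ξ : R3) : ‖nl Q ξ‖ ≤ ‖Q‖ ^ 2 := by
  refine (IsFourierPair.norm_fourier_le _ _).trans ?_
  rw [norm_sq_eq_integral]
  simp only [norm_complexify]
  exact integral_mono (integrable_sq Q).norm (integrable_norm_sq Q) fun x => norm_matSq_le _

theorem norm_nl_sub_le (Q R : L2Mat) (ξ : R3) :
    ‖nl Q ξ - nl R ξ‖ ≤ (‖Q‖ + ‖R‖) * ‖Q - R‖ := by
  have hi : ∀ P : L2Mat, Integrable fun x => complexify (sq P x) := fun P =>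
    complexify.integrable_comp (integrable_sq P)
  have h1 : nl Q ξ - nl R ξ = 𝓕 (fun x => complexify (sq Q x) - complexify (sq R x)) ξ := by
    simp only [nl, Real.fourier_eq, smul_sub]
    rw [integral_sub]
    · exact (Real.fourierIntegral_convergent_iff ξ).2 (hi Q)
    · exact (Real.fourierIntegral_convergent_iff ξ).2 (hi R)
  rw [h1]
  refine (IsFourierPair.norm_fourier_le _ _).trans ?_
  have h2 : ∀ᵐ x : R3, ‖complexify (sq Q x) - complexify (sq R x)‖ ≤
      ‖Q x‖ * ‖(Q - R) x‖ + ‖(Q - R) x‖ * ‖R x‖ := by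
    filter_upwards [Lp.coeFn_sub Q R] with x hx
    rw [← map_sub, norm_complexify, hx]
    exact norm_matSq_sub_le _ _
  refine (integral_mono_ae ((hi Q).sub (hi R)).norm
    ((integrable_norm_mul_norm _ _).add (integrable_norm_mul_norm _ _)) h2).trans ?_
  simp only [Pi.add_apply]
  rw [integral_add (integrable_norm_mul_norm _ _) (integrable_norm_mul_norm _ _)]
  have a := integral_norm_mul_norm_le Q (Q - R)
  have b := integral_norm_mul_norm_le (Q - R) R
  linarith

/-- `nl` is locally Lipschitz in the field, uniformly in the frequency, and continuous in the
frequency. Joint continuity later gives joint measurability of the forcing in time and frequency, as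
Fubini requires. -/
theorem continuous_nl : Continuous fun p : L2Mat × R3 => nl p.1 p.2 := by
  refine continuous_iff_continuousAt.2 fun ⟨Q, ξ⟩ => ?_
  refine tendsto_iff_norm_sub_tendsto_zero.2 ?_
  have hc : Continuous (nl Q) :=
    IsFourierPair.continuous_fourier (complexify.integrable_comp (integrable_sq Q))
  have hlim : Filter.Tendsto (fun p : L2Mat × R3 => (‖p.1‖ + ‖Q‖) * ‖p.1 - Q‖ +
      ‖nl Q p.2 - nl Q ξ‖) (nhds (Q, ξ)) (nhds 0) := by
    have : Continuous fun p : L2Mat × R3 => (‖p.1‖ + ‖Q‖) * ‖p.1 - Q‖ +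
      ‖nl Q p.2 - nl Q ξ‖ := by fun_prop
    simpa using this.tendsto (Q, ξ)
  refine squeeze_zero (fun _ => norm_nonneg _) (fun p => ?_) hlim
  calc ‖nl p.1 p.2 - nl Q ξ‖ = ‖(nl p.1 p.2 - nl Q p.2) + (nl Q p.2 - nl Q ξ)‖ := by
        rw [sub_add_sub_cancel]
    _ ≤ _ := (norm_add_le _ _).trans (by gcongr; exact norm_nl_sub_le _ _ _)

/-- The map placing column `k` into row `j`. -/
def colToRow (j k : Fin 3) : CMat3 →L[ℂ] CMat3 :=
  LinearMap.toContinuousLinearMap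
    { toFun := fun A => WithLp.toLp 2 fun p => if p.1 = j then A (p.2, k) else 0
      map_add' := fun A B => by ext p; by_cases h : p.1 = j <;> simp [h]
      map_smul' := fun c A => by ext p; by_cases h : p.1 = j <;> simp [h] }

theorem colToRow_apply (j k : Fin 3) (A : CMat3) (p : Fin 3 × Fin 3) :
    colToRow j k A p = if p.1 = j then A (p.2, k) else 0 := rfl

theorem norm_colToRow_le (j k : Fin 3) (A : CMat3) : ‖colToRow j k A‖ ≤ ‖A‖ := by
  refine abs_le_of_sq_le_sq' ?_ (by positivity) |>.2
  rw [EuclideanSpace.norm_sq_eq, EuclideanSpace.norm_sq_eq, Fintype.sum_prod_type,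
    Finset.sum_eq_single j, Fintype.sum_prod_type_right]
  · simp only [colToRow_apply, if_true]
    exact Finset.single_le_sum (f := fun k => ∑ b, ‖A (b, k)‖ ^ 2)
      (fun _ _ => by positivity) (Finset.mem_univ k)
  · intro i _ hi
    simp [colToRow_apply, hi]
  · simp

/-- This writes an entry of the square as an inner product of two linear images of `A`, the form to
which Parseval applies. -/
theorem inner_colToRow (A : Mat3) (j k : Fin 3) :
    inner ℂ (complexify A) (colToRow j k (complexify A)) = complexify (matSq A) (j, k) := by
  rw [PiLp.inner_apply, Fintype.sum_prod_type, Finset.sum_eq_single j]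
  · simp [colToRow_apply, matSq_eq, matMul, mul_comm]
  · intro i _ hi
    simp [colToRow_apply, hi]
  · simp

/-- The transform of `(Q²)_jk` at `ξ` is the `L²` inner product of `Q` with a modulated copy of
`colToRow j k Q`; modulation becomes translation under Parseval. -/
theorem nl_apply_eq (Q : L2Mat) (ξ : R3) (j k : Fin 3) :
    nl Q ξ (j, k) = ∫ η, inner ℂ (hat Q η) (colToRow j k (hat Q (η + ξ))) := by
  have hp := isFourierPair_hat Q
  rw [← hp.integral_inner ((hp.clm (colToRow j k)).modulate ξ)]
  have hi : Integrable fun x => 𝐞 (-inner ℝ x ξ) • complexify (sq Q x) :=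
    (Real.fourierIntegral_convergent_iff ξ).2 (complexify.integrable_comp (integrable_sq Q))
  have h1 : nl Q ξ (j, k) = ∫ x, (𝐞 (-inner ℝ x ξ) • complexify (sq Q x)) (j, k) := by
    rw [nl, Real.fourier_eq]
    exact ((EuclideanSpace.proj (𝕜 := ℂ) (j, k)).integral_comp_comm hi).symm
  rw [h1]
  congr with x
  rw [Circle.smul_def, Circle.smul_def, inner_smul_right, inner_colToRow]
  rfl

/-- Since `1 + |ξ| ≤ (1 + |η|)(1 + |η + ξ|)`, the weight splits over the two factors of the
correlation. Then `xy ≤ (x² + y²)/2` and translation invariance bound each entry by the integral.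
The factor 3 is the square root of the number of entries, nine. -/
theorem integral_weight_nl_le {ρ : ℝ} (hρ : 0 ≤ ρ) (Q : L2Mat) {g : R3 → ℝ}
    (hg : ∀ᵐ ξ, ‖hat Q ξ‖ ≤ g ξ) (hL : MemLp (fun ξ : R3 => (1 + ‖ξ‖) ^ ρ * g ξ) 2 volume)
    (ξ : R3) :
    (1 + ‖ξ‖) ^ ρ * ‖nl Q ξ‖ ≤ 3 * ∫ η : R3, ((1 + ‖η‖) ^ ρ * g η) ^ 2 := by
  set h : R3 → ℝ := fun η => (1 + ‖η‖) ^ ρ * g η with hh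
  have hsq : Integrable fun η => h η ^ 2 := (memLp_two_iff_integrable_sq hL.1).1 hL
  have hsq' : Integrable fun η => h (η + ξ) ^ 2 := hsq.comp_add_right ξ
  have hL' : MemLp (fun η => h (η + ξ)) 2 volume :=
    hL.comp_measurePreserving (measurePreserving_add_right volume ξ)
  have hg' : ∀ᵐ η, ‖hat Q (η + ξ)‖ ≤ g (η + ξ) :=
    (measurePreserving_add_right (volume : Measure R3) ξ).quasiMeasurePreserving.ae hg
  have hcomp : ∀ j k, (1 + ‖ξ‖) ^ ρ * ‖nl Q ξ (j, k)‖ ≤ ∫ η, h η ^ 2 := by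
    intro j k
    rw [nl_apply_eq, ← Real.norm_of_nonneg (r := (1 + ‖ξ‖) ^ ρ) (by positivity),
      ← norm_smul, ← integral_smul]
    calc _ ≤ ∫ η, (h η ^ 2 / 2 + h (η + ξ) ^ 2 / 2) := by
          refine norm_integral_le_of_norm_le ((hsq.div_const 2).add (hsq'.div_const 2)) ?_
          filter_upwards [hg, hg'] with η h1 h2
          have hw : (1 + ‖ξ‖) ^ ρ ≤ (1 + ‖η‖) ^ ρ * (1 + ‖η + ξ‖) ^ ρ := by
            rw [← Real.mul_rpow (by positivity) (by positivity)]
            refine Real.rpow_le_rpow (by positivity) ?_ hρ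
            have : ‖ξ‖ ≤ ‖η + ξ‖ + ‖η‖ := by
              simpa using norm_sub_le (η + ξ) η
            nlinarith [norm_nonneg η, norm_nonneg (η + ξ)]
          have h3 : ‖inner ℂ (hat Q η) (colToRow j k (hat Q (η + ξ)))‖ ≤ g η * g (η + ξ) :=
            (norm_inner_le_norm _ _).trans (mul_le_mul h1
              ((norm_colToRow_le _ _ _).trans h2) (norm_nonneg _) ((norm_nonneg _).trans h1))
          have h4 : ‖(1 + ‖ξ‖) ^ ρ • inner ℂ (hat Q η) (colToRow j k (hat Q (η + ξ)))‖ ≤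
              h η * h (η + ξ) := by
            rw [norm_smul, Real.norm_of_nonneg (by positivity)]
            calc _ ≤ ((1 + ‖η‖) ^ ρ * (1 + ‖η + ξ‖) ^ ρ) * (g η * g (η + ξ)) := by
                  gcongr
              _ = _ := by rw [hh]; ring
          nlinarith [sq_nonneg (h η - h (η + ξ))]
      _ = ∫ η, h η ^ 2 := by
          rw [integral_add (hsq.div_const 2) (hsq'.div_const 2), integral_div, integral_div,
            integral_add_right_eq_self (fun η => h η ^ 2) ξ]
          ring
  set M := ∫ η, h η ^ 2
  have hM : 0 ≤ M := integral_nonneg fun _ => sq_nonneg _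
  refine abs_le_of_sq_le_sq' ?_ (by positivity) |>.2
  rw [mul_pow, EuclideanSpace.norm_sq_eq, Finset.mul_sum]
  calc ∑ p, ((1 + ‖ξ‖) ^ ρ) ^ 2 * ‖nl Q ξ p‖ ^ 2 ≤ ∑ p : Fin 3 × Fin 3, M ^ 2 := by
        refine Finset.sum_le_sum fun p _ => ?_
        rw [← mul_pow]
        gcongr
        exact hcomp p.1 p.2
    _ = (3 * M) ^ 2 := by
        simp
        ring

end Nonlinearity

/-! ### The heat semigroup on the Fourier side -/

section Heat

open ComplexConjugate

/-- The symbol `(2π|ξ|)²` of `-Δ`. -/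
def rate (ξ : R3) : ℝ := (2 * Real.pi * ‖ξ‖) ^ 2

theorem rate_nonneg (ξ : R3) : 0 ≤ rate ξ := sq_nonneg _

@[fun_prop]
theorem continuous_rate : Continuous rate := by
  unfold rate
  fun_prop

theorem integrable_cexp_gaussian {t : ℝ} (ht : 0 < t) (x : R3) : Integrable fun ξ : R3 =>
    Complex.exp (-(t * (2 * Real.pi) ^ 2 : ℝ) * ‖ξ‖ ^ 2 +
      2 * Real.pi * Complex.I * inner ℝ x ξ) := by
  have hb : 0 < (((t * (2 * Real.pi) ^ 2 : ℝ)) : ℂ).re := by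
    rw [Complex.ofReal_re]
    positivity
  exact GaussianFourier.integrable_cexp_neg_mul_sq_norm_add hb (2 * Real.pi * Complex.I) x

theorem cexp_gaussian_eq (t : ℝ) (x ξ : R3) :
    Complex.exp (-(t * (2 * Real.pi) ^ 2 : ℝ) * ‖ξ‖ ^ 2 +
      2 * Real.pi * Complex.I * inner ℝ x ξ) =
    𝐞 (inner ℝ ξ x) • ((Real.exp (-(t * rate ξ)) : ℝ) : ℂ) := by
  rw [Circle.smul_def, Real.fourierChar_apply, smul_eq_mul, Complex.ofReal_exp, ← Complex.exp_add,
    real_inner_comm, rate]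
  congr 1
  push_cast
  ring

theorem norm_cexp_gaussian (t : ℝ) (x ξ : R3) :
    ‖Complex.exp (-(t * (2 * Real.pi) ^ 2 : ℝ) * ‖ξ‖ ^ 2 +
      2 * Real.pi * Complex.I * inner ℝ x ξ)‖ = Real.exp (-(t * rate ξ)) := by
  rw [cexp_gaussian_eq, Circle.norm_smul, Complex.norm_real, Real.norm_of_nonneg (by positivity)]

theorem integrable_exp_rate {t : ℝ} (ht : 0 < t) :
    Integrable fun ξ : R3 => Real.exp (-(t * rate ξ)) := by
  have h := (integrable_cexp_gaussian ht 0).norm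
  simpa only [norm_cexp_gaussian] using h

theorem exp_rate_sq (t : ℝ) (ξ : R3) :
    Real.exp (-(t * rate ξ)) ^ 2 = Real.exp (-(2 * t * rate ξ)) := by
  rw [← Real.exp_nat_mul]
  congr 1
  push_cast
  ring

theorem memLp_exp_rate {t : ℝ} (ht : 0 < t) :
    MemLp (fun ξ : R3 => Real.exp (-(t * rate ξ))) 2 volume := by
  refine (memLp_two_iff_integrable_sq (Continuous.aestronglyMeasurable (by fun_prop))).2 ?_
  simp only [exp_rate_sq]
  exact integrable_exp_rate (by positivity)

theorem integral_exp_rate {t : ℝ} (ht : 0 < t) :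
    ∫ ξ : R3, Real.exp (-(t * rate ξ)) = (4 * Real.pi * t) ^ (-(3 / 2) : ℝ) := by
  have hb : 0 < t * (2 * Real.pi) ^ 2 := by positivity
  have h := GaussianFourier.integral_rexp_neg_mul_sq_norm (V := R3) hb
  have e : ∀ ξ : R3, -(t * (2 * Real.pi) ^ 2) * ‖ξ‖ ^ 2 = -(t * rate ξ) := by
    intro ξ
    rw [rate]
    ring
  simp only [e] at h
  rw [h, Real.rpow_neg (by positivity), ← Real.inv_rpow (by positivity)]
  have : Real.pi / (t * (2 * Real.pi) ^ 2) = (4 * Real.pi * t)⁻¹ := by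
    field_simp
    ring
  rw [this]
  simp

/-- The heat kernel centred at `x` is the transform of a modulated Gaussian. Hence `heat t f x` is a
pairing with a transform, and duality moves the transform onto `f`. -/
theorem fourier_cexp_gaussian {t : ℝ} (ht : 0 < t) (x w : R3) :
    𝓕 (fun ξ : R3 => Complex.exp (-(t * (2 * Real.pi) ^ 2 : ℝ) * ‖ξ‖ ^ 2 +
      2 * Real.pi * Complex.I * inner ℝ x ξ)) w = (heatKernel t (x - w) : ℂ) := by
  have hb : 0 < (((t * (2 * Real.pi) ^ 2 : ℝ)) : ℂ).re := by
    rw [Complex.ofReal_re]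
    positivity
  rw [fourier_gaussian_innerProductSpace' hb x w, heatKernel]
  have hpos : 0 < Real.pi / (t * (2 * Real.pi) ^ 2) := by positivity
  have h1 : (Real.pi : ℂ) / ((t * (2 * Real.pi) ^ 2 : ℝ) : ℂ) =
      ((Real.pi / (t * (2 * Real.pi) ^ 2) : ℝ) : ℂ) := by
    push_cast
    rfl
  have h2 : (Module.finrank ℝ R3 / 2 : ℂ) = ((3 / 2 : ℝ) : ℂ) := by
    simp
  have h3 : Real.pi / (t * (2 * Real.pi) ^ 2) = (4 * Real.pi * t)⁻¹ := by
    field_simp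
    ring
  rw [h1, h2, ← Complex.ofReal_cpow hpos.le, h3, Real.inv_rpow (by positivity),
    ← Real.rpow_neg (by positivity)]
  push_cast
  congr 2
  have : (Real.pi : ℂ) ≠ 0 := by exact_mod_cast Real.pi_ne_zero
  have : (t : ℂ) ≠ 0 := by exact_mod_cast ht.ne'
  field_simp
  norm_num

theorem continuous_heatKernel (t : ℝ) : Continuous (heatKernel t) := by
  unfold heatKernel
  fun_prop

/-- This extends the defining identity of a pair from Schwartz functions to `φ ∈ L¹ ∩ L²`. Because
`conj (𝓕 φ)` is the inverse transform of `conj φ`, it is Parseval tested against each fixed vector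
`v`. -/
theorem integral_smul_eq_of_pair {F : Type*} [NormedAddCommGroup F] [InnerProductSpace ℂ F]
    [CompleteSpace F] {f g : R3 → F} (h : IsFourierPair f g) {φ : R3 → ℂ} (hφ : Integrable φ)
    (hφ2 : MemLp φ 2 volume) : MemLp (𝓕 φ) 2 volume ∧ ∫ x, φ x • g x = ∫ x, 𝓕 φ x • f x := by
  have hpair := IsFourierPair.of_integrable hφ hφ2
  refine ⟨hpair.2, ?_⟩
  have hi1 : Integrable fun x => φ x • g x := memLp_one_iff_integrable.1 (h.2.smul hφ2)
  have hi2 : Integrable fun x => 𝓕 φ x • f x := memLp_one_iff_integrable.1 (h.1.smul hpair.2)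
  refine ext_inner_left ℂ fun v => ?_
  have hc : Integrable fun x => conj (φ x) :=
    (Complex.conjCLE : ℂ →L[ℝ] ℂ).integrable_comp hφ
  have hc2 : MemLp (fun x => conj (φ x)) 2 volume :=
    (Complex.conjCLE : ℂ →L[ℝ] ℂ).comp_memLp' hφ2
  have hF : 𝓕⁻ (fun x => conj (φ x)) = fun x => conj (𝓕 φ x) := by
    ext x
    rw [Real.fourierInv_eq, Real.fourier_eq, ← integral_conj]
    congr with y
    simp [Circle.smul_def, ← Circle.coe_inv_eq_conj, AddChar.map_neg_eq_inv]
  have hp := (IsFourierPair.of_integrable_right hc hc2).clm (ContinuousLinearMap.toSpanSingleton ℂ v)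
  rw [hF] at hp
  have := hp.integral_inner h
  simp only [ContinuousLinearMap.toSpanSingleton_apply, inner_smul_left, Complex.conj_conj] at this
  rw [← integral_inner hi1, ← integral_inner hi2]
  simp only [inner_smul_right]
  exact this.symm

theorem heat_eq_integral (t : ℝ) (f : R3 → Mat3) (x : R3) :
    heat t f x = ∫ y, heatKernel t (x - y) • f y := by
  rw [heat, convolution_eq_swap]
  rfl

theorem complexify_heat {t : ℝ} (ht : 0 < t) {f : R3 → Mat3} (x : R3)
    (hi : Integrable fun y => heatKernel t (x - y) • f y) :
    complexify (heat t f x) = ∫ y, 𝓕 (fun ξ : R3 => Complex.exp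
      (-(t * (2 * Real.pi) ^ 2 : ℝ) * ‖ξ‖ ^ 2 + 2 * Real.pi * Complex.I * inner ℝ x ξ)) y •
        complexify (f y) := by
  rw [heat_eq_integral, ← complexify.integral_comp_comm hi]
  congr with y
  rw [fourier_cexp_gaussian ht]
  simp

theorem memLp_cexp_gaussian {t : ℝ} (ht : 0 < t) (x : R3) : MemLp (fun ξ : R3 => Complex.exp
    (-(t * (2 * Real.pi) ^ 2 : ℝ) * ‖ξ‖ ^ 2 + 2 * Real.pi * Complex.I * inner ℝ x ξ)) 2
      volume := by
  refine (memLp_exp_rate ht).of_le (integrable_cexp_gaussian ht x).1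
    (Filter.Eventually.of_forall fun ξ => ?_)
  rw [norm_cexp_gaussian]
  exact le_abs_self _

theorem memLp_heatKernel_sub {t : ℝ} (ht : 0 < t) (x : R3) :
    MemLp (fun y => heatKernel t (x - y)) 2 volume := by
  have h := (IsFourierPair.of_integrable (integrable_cexp_gaussian ht x)
    (memLp_cexp_gaussian ht x)).2
  have h2 := Complex.reCLM.comp_memLp' h
  have e : (Complex.reCLM ∘ 𝓕 (fun ξ : R3 => Complex.exp
      (-(t * (2 * Real.pi) ^ 2 : ℝ) * ‖ξ‖ ^ 2 + 2 * Real.pi * Complex.I * inner ℝ x ξ))) =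
      fun y => heatKernel t (x - y) := by
    ext y
    simp only [Function.comp_apply, fourier_cexp_gaussian ht]
    simp
  rwa [e] at h2

theorem norm_heatKernel_le {t : ℝ} (ht : 0 < t) (x : R3) :
    ‖heatKernel t x‖ ≤ (4 * Real.pi * t) ^ (-(3 / 2) : ℝ) := by
  rw [heatKernel, norm_mul, Real.norm_of_nonneg (by positivity), Real.norm_of_nonneg (by positivity)]
  refine mul_le_of_le_one_right (by positivity) (Real.exp_le_one_iff.2 ?_)
  rw [neg_div]
  simp only [Left.neg_nonpos_iff]
  positivity

theorem integral_cexp_gaussian_smul (t : ℝ) (x : R3) (u : R3 → CMat3) :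
    ∫ ξ, Complex.exp (-(t * (2 * Real.pi) ^ 2 : ℝ) * ‖ξ‖ ^ 2 +
      2 * Real.pi * Complex.I * inner ℝ x ξ) • u ξ =
    𝓕⁻ (fun ξ => Real.exp (-(t * rate ξ)) • u ξ) x := by
  rw [Real.fourierInv_eq]
  congr with ξ
  rw [cexp_gaussian_eq, smul_assoc, Complex.coe_smul]

/-- This version serves `S² ∈ L¹`: duality is the classical multiplication formula, and the Gaussian
times a bounded transform lies in `L¹ ∩ L²`. For the `L²` initial datum, `isFourierPair_heat` uses
the extended duality `integral_smul_eq_of_pair` instead. -/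
theorem isFourierPair_heat_of_integrable {t : ℝ} (ht : 0 < t) {f : R3 → Mat3} (hf : Integrable f) :
    IsFourierPair (fun x => complexify (heat t f x))
      (fun ξ => Real.exp (-(t * rate ξ)) • 𝓕 (fun x => complexify (f x)) ξ) := by
  have hcf := complexify.integrable_comp hf
  have h1 : (fun x => complexify (heat t f x)) =
      𝓕⁻ (fun ξ => Real.exp (-(t * rate ξ)) • 𝓕 (fun x => complexify (f x)) ξ) := by
    ext1 x
    rw [complexify_heat ht x, IsFourierPair.integral_fourier_smul_eq_flip
      (integrable_cexp_gaussian ht x) hcf, integral_cexp_gaussian_smul]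
    refine hf.bdd_smul ((4 * Real.pi * t) ^ (-(3 / 2) : ℝ))
      (Continuous.aestronglyMeasurable ?_)
      (Filter.Eventually.of_forall fun y => norm_heatKernel_le ht _)
    exact (continuous_heatKernel t).comp (by fun_prop)
  have hm : AEStronglyMeasurable (𝓕 (fun x => complexify (f x))) volume :=
    (IsFourierPair.continuous_fourier hcf).aestronglyMeasurable
  have hb : ∀ ξ, ‖Real.exp (-(t * rate ξ)) • 𝓕 (fun x => complexify (f x)) ξ‖ ≤
      (∫ x, ‖complexify (f x)‖) * ‖Real.exp (-(t * rate ξ))‖ := by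
    intro ξ
    rw [norm_smul, mul_comm]
    gcongr
    exact IsFourierPair.norm_fourier_le _ _
  have hM : AEStronglyMeasurable (fun ξ => Real.exp (-(t * rate ξ)) •
      𝓕 (fun x => complexify (f x)) ξ) volume :=
    AEStronglyMeasurable.smul (f := fun ξ => Real.exp (-(t * rate ξ)))
      (Continuous.aestronglyMeasurable (by fun_prop)) hm
  rw [h1]
  refine IsFourierPair.of_integrable_right ?_ ?_
  · exact ((integrable_exp_rate ht).norm.const_mul _).mono' hM (Filter.Eventually.of_forall hb)
  · exact (memLp_exp_rate ht).of_le_mul hM (Filter.Eventually.of_forall hb)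

theorem norm_exp_rate_le_one {t : ℝ} (ht : 0 ≤ t) (ξ : R3) : ‖Real.exp (-(t * rate ξ))‖ ≤ 1 := by
  rw [Real.norm_of_nonneg (by positivity), Real.exp_le_one_iff]
  have := mul_nonneg ht (rate_nonneg ξ)
  linarith

theorem isFourierPair_heat {t : ℝ} (ht : 0 < t) (S : L2Mat) :
    IsFourierPair (fun x => complexify (heat t S x))
      (fun ξ => Real.exp (-(t * rate ξ)) • hat S ξ) := by
  have h1 : (fun x => complexify (heat t S x)) =
      𝓕⁻ (fun ξ => Real.exp (-(t * rate ξ)) • hat S ξ) := by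
    ext1 x
    rw [complexify_heat ht x, ← (integral_smul_eq_of_pair (isFourierPair_hat S)
      (integrable_cexp_gaussian ht x) (memLp_cexp_gaussian ht x)).2, integral_cexp_gaussian_smul]
    exact memLp_one_iff_integrable.1 ((Lp.memLp S).smul (memLp_heatKernel_sub ht x))
  rw [h1]
  refine IsFourierPair.of_integrable_right ?_ ?_
  · exact memLp_one_iff_integrable.1 ((Lp.memLp (hat S)).smul (memLp_exp_rate ht))
  · refine (Lp.memLp (hat S)).of_le (AEStronglyMeasurable.smul
      (f := fun ξ => Real.exp (-(t * rate ξ))) (Continuous.aestronglyMeasurable (by fun_prop))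
      (Lp.aestronglyMeasurable _)) (Filter.Eventually.of_forall fun ξ => ?_)
    rw [norm_smul]
    exact mul_le_of_le_one_left (norm_nonneg _) (norm_exp_rate_le_one ht.le ξ)

theorem hat_toL2_heat {t : ℝ} (ht : 0 < t) (S : L2Mat) :
    hat (toL2 (heat t S)) =ᵐ[volume] fun ξ => Real.exp (-(t * rate ξ)) • hat S ξ :=
  hat_toL2 (isFourierPair_heat ht S)

theorem hat_Pst_toL2_heat_sq {t : ℝ} (ht : 0 < t) (Q : L2Mat) :
    hat (Pst (toL2 (heat t (sq Q)))) =ᵐ[volume]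
      fun ξ => Real.exp (-(t * rate ξ)) • symbol ξ (nl Q ξ) := by
  filter_upwards [hat_Pst (toL2 (heat t (sq Q))),
    hat_toL2 (isFourierPair_heat_of_integrable ht (integrable_sq Q))] with ξ h1 h2
  rw [h1, h2]
  simp [nl, ← Complex.coe_smul]

end Heat

/-! ### The Duhamel formula, frequency by frequency -/

section Duhamel

open Filter Topology

/-- `hat` as a real linear map. -/
def hatL : L2Mat →L[ℝ] Lp (α := R3) CMat3 2 :=
  LinearMap.mkContinuous
    { toFun := hat
      map_add' := hat_add
      map_smul' := fun c S => by
        rw [hat_smul]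
        exact Complex.coe_smul c (hat S) } 1 fun S => by simp [norm_hat]

@[simp]
theorem hatL_apply (S : L2Mat) : hatL S = hat S := rfl

theorem hat_sub (S Q : L2Mat) : hat (S - Q) = hat S - hat Q := map_sub hatL S Q

/-- A Bochner integral in `L²` is computed pointwise. -/
theorem coeFn_intervalIntegral_Lp {H : ℝ → Lp (α := R3) CMat3 2} {h : ℝ → R3 → CMat3} {t M : ℝ}
    (ht : 0 ≤ t) (hH : IntervalIntegrable H volume 0 t)
    (hHh : ∀ τ ∈ Set.Ioc 0 t, H τ =ᵐ[volume] h τ)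
    (hm : AEStronglyMeasurable (Function.uncurry h) (volume.prod volume))
    (hM : ∀ τ ∈ Set.Ioc 0 t, ∀ ξ, ‖h τ ξ‖ ≤ M) :
    ((∫ τ in (0 : ℝ)..t, H τ : Lp (α := R3) CMat3 2) : R3 → CMat3) =ᵐ[volume]
      fun ξ => ∫ τ in (0 : ℝ)..t, h τ ξ := by
  have hprod : ∀ s : Set R3, MeasurableSet s → volume s < ⊤ →
      Integrable (Function.uncurry h) ((volume.restrict (Set.Ioc 0 t)).prod (volume.restrict s)) := by
    intro s hs hsf
    have : IsFiniteMeasure (volume.restrict s) := ⟨by simpa using hsf⟩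
    have hr : (volume.restrict (Set.Ioc (0 : ℝ) t)).prod (volume.restrict s) =
        (volume.prod volume).restrict (Set.Ioc (0 : ℝ) t ×ˢ s) := Measure.prod_restrict _ _
    refine Integrable.of_bound (C := M) ?_ ?_
    · rw [hr]
      exact hm.restrict
    · rw [hr]
      filter_upwards [ae_restrict_mem (measurableSet_Ioc.prod hs)] with p hp
      exact hM _ hp.1 _
  -- It suffices to compare integrals over sets `s` of finite measure. Pairing with `c` times the
  -- indicator of `s` is a continuous functional, so it commutes with the Bochner integral; Fubini
  -- on `(0, t] × s` handles the pointwise side.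
  refine ae_eq_of_forall_setIntegral_eq_of_sigmaFinite (fun s hs hsf =>
    integrableOn_Lp_of_measure_ne_top _ fact_one_le_two_ennreal.elim hsf.ne) (fun s hs hsf => ?_)
    (fun s hs hsf => ?_)
  · simp only [intervalIntegral.integral_of_le ht]
    exact (hprod s hs hsf).integral_prod_right
  · refine ext_inner_left ℂ fun c => ?_
    rw [← L2.inner_indicatorConstLp_eq_inner_setIntegral ℂ hs hsf.ne c,
      ← innerSL_apply_apply (𝕜 := ℂ), ← ContinuousLinearMap.intervalIntegral_comp_comm _ hH]
    simp only [innerSL_apply_apply, L2.inner_indicatorConstLp_eq_inner_setIntegral,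
      intervalIntegral.integral_of_le ht]
    rw [← integral_integral_swap (hprod s hs hsf)]
    have hl : Integrable (fun τ => ∫ ξ in s, h τ ξ) (volume.restrict (Set.Ioc 0 t)) :=
      (hprod s hs hsf).integral_prod_left
    rw [← integral_inner hl]
    refine setIntegral_congr_fun measurableSet_Ioc fun τ hτ => ?_
    rw [setIntegral_congr_ae hs ((hHh τ hτ).mono fun ξ hξ _ => hξ)]

/-- The projected nonlinearity on the Fourier side. -/
def forcing (S : ℝ → L2Mat) (s : ℝ) (ξ : R3) : CMat3 := symbol ξ (nl (S s) ξ)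

theorem norm_forcing_le (S : ℝ → L2Mat) (s : ℝ) (ξ : R3) : ‖forcing S s ξ‖ ≤ ‖S s‖ ^ 2 :=
  (norm_symbol_le _ _).trans (norm_nl_le _ _)

variable {S : ℝ → L2Mat} (hS : Continuous S)

include hS

theorem continuous_nl_uncurry : Continuous fun p : ℝ × R3 => nl (S p.1) p.2 :=
  Continuous.comp (g := fun p : L2Mat × R3 => nl p.1 p.2) (f := fun p : ℝ × R3 => (S p.1, p.2))
    continuous_nl ((hS.comp continuous_fst).prodMk continuous_snd)

theorem continuous_forcing (ξ : R3) : Continuous fun s => forcing S s ξ :=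
  Continuous.comp (g := symbol ξ) (f := fun s => nl (S s) ξ) (symbol ξ).continuous
    (Continuous.comp (g := fun p : ℝ × R3 => nl (S p.1) p.2) (f := fun s => (s, ξ))
      (continuous_nl_uncurry hS) (Continuous.prodMk_left ξ))

theorem measurable_forcing : Measurable fun p : ℝ × R3 => forcing S p.1 p.2 :=
  Measurable.comp (g := fun q : R3 × CMat3 => symbol q.1 q.2)
    (f := fun p : ℝ × R3 => (p.2, nl (S p.1) p.2)) measurable_symbol
    (measurable_snd.prodMk (continuous_nl_uncurry hS).measurable)

theorem exists_norm_forcing_le (b : ℝ) :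
    ∃ M, 0 ≤ M ∧ ∀ s, 0 ≤ s → s ≤ b → ∀ ξ, ‖forcing S s ξ‖ ≤ M := by
  obtain ⟨C, hC⟩ := (isCompact_Icc (a := 0) (b := b)).exists_bound_of_continuousOn
    (f := fun s => ‖S s‖ ^ 2) (by fun_prop)
  refine ⟨max C 0, le_max_right _ _, fun s h0 h1 ξ => ?_⟩
  refine (norm_forcing_le S s ξ).trans ((le_abs_self _).trans ((hC s ⟨h0, h1⟩).trans
    (le_max_left _ _)))

theorem measurable_duhamel (t : ℝ) : Measurable fun p : ℝ × R3 =>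
    Real.exp (-(p.1 * rate p.2)) • forcing S (t - p.1) p.2 := by
  have h1 : Measurable fun p : ℝ × R3 => forcing S (t - p.1) p.2 :=
    Measurable.comp (g := fun p : ℝ × R3 => forcing S p.1 p.2)
      (f := fun p : ℝ × R3 => (t - p.1, p.2)) (measurable_forcing hS)
      (Measurable.prodMk (by fun_prop) measurable_snd)
  have h2 : Measurable fun p : ℝ × R3 => Real.exp (-(p.1 * rate p.2)) :=
    Continuous.measurable (by fun_prop)
  exact h2.smul h1

/-- It provides the strong measurability of the Duhamel integrand in `L²`. For `τ` in `[τ₀/2, 2τ₀]`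
the transforms are dominated by a fixed Gaussian, so Plancherel and dominated convergence apply. -/
theorem continuousAt_duhamel {t τ₀ : ℝ} (h0 : 0 < τ₀) :
    ContinuousAt (fun τ => Pst (toL2 (heat τ (sq (S (t - τ)))))) τ₀ := by
  refine tendsto_iff_norm_sub_tendsto_zero.2 ?_
  obtain ⟨C, hC⟩ := (isCompact_Icc (a := τ₀ / 2) (b := 2 * τ₀)).exists_bound_of_continuousOn
    (f := fun τ => ‖S (t - τ)‖ ^ 2) (by fun_prop)
  set h : ℝ → R3 → CMat3 := fun τ ξ => Real.exp (-(τ * rate ξ)) • forcing S (t - τ) ξ with hh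
  have hmem : ∀ᶠ τ in 𝓝 τ₀, τ ∈ Set.Icc (τ₀ / 2) (2 * τ₀) :=
    Icc_mem_nhds (by linarith) (by linarith)
  have hbd : ∀ τ ∈ Set.Icc (τ₀ / 2) (2 * τ₀), ∀ ξ,
      ‖h τ ξ‖ ≤ C * Real.exp (-(τ₀ / 2 * rate ξ)) := by
    intro τ hτ ξ
    rw [hh, norm_smul, Real.norm_of_nonneg (by positivity), mul_comm]
    have h1 : ‖forcing S (t - τ) ξ‖ ≤ C :=
      (norm_forcing_le _ _ _).trans ((le_abs_self _).trans (hC τ hτ))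
    have h2 : Real.exp (-(τ * rate ξ)) ≤ Real.exp (-(τ₀ / 2 * rate ξ)) := by
      have := mul_le_mul_of_nonneg_right hτ.1 (rate_nonneg ξ)
      exact Real.exp_le_exp.2 (by linarith)
    exact mul_le_mul h1 h2 (by positivity) ((norm_nonneg _).trans h1)
  have hh0 : τ₀ ∈ Set.Icc (τ₀ / 2) (2 * τ₀) := ⟨by linarith, by linarith⟩
  have hmeas : ∀ τ, Measurable (h τ) := fun τ =>
    (measurable_duhamel hS t).comp measurable_prodMk_left
  have hlim : Tendsto (fun τ => ∫ ξ, ‖h τ ξ - h τ₀ ξ‖ ^ 2) (𝓝 τ₀) (𝓝 (∫ _ : R3, (0 : ℝ))) := by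
    refine tendsto_integral_filter_of_dominated_convergence
      (fun ξ => (2 * C) ^ 2 * Real.exp (-(τ₀ * rate ξ))) ?_ ?_ ?_ ?_
    · exact Eventually.of_forall fun τ =>
        (((hmeas τ).sub (hmeas τ₀)).norm.pow_const 2).aestronglyMeasurable
    · filter_upwards [hmem] with τ hτ
      refine Eventually.of_forall fun ξ => ?_
      rw [Real.norm_of_nonneg (by positivity)]
      have h1 : ‖h τ ξ - h τ₀ ξ‖ ≤ 2 * C * Real.exp (-(τ₀ / 2 * rate ξ)) := by
        have a := norm_sub_le (h τ ξ) (h τ₀ ξ)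
        have b := hbd τ hτ ξ
        have c := hbd τ₀ hh0 ξ
        linarith
      calc ‖h τ ξ - h τ₀ ξ‖ ^ 2 ≤ (2 * C * Real.exp (-(τ₀ / 2 * rate ξ))) ^ 2 := by gcongr
        _ = _ := by
          rw [mul_pow, exp_rate_sq]
          ring_nf
    · exact (integrable_exp_rate h0).const_mul _
    · refine Eventually.of_forall fun ξ => ?_
      have hc : Continuous fun τ => ‖h τ ξ - h τ₀ ξ‖ ^ 2 := by
        have := continuous_forcing hS ξ
        have h3 : Continuous fun τ => forcing S (t - τ) ξ := this.comp (by fun_prop)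
        simp only [hh]
        fun_prop
      simpa using hc.tendsto τ₀
  rw [integral_zero] at hlim
  have hlim2 := (Real.continuous_sqrt.tendsto 0).comp hlim
  rw [Real.sqrt_zero] at hlim2
  refine hlim2.congr' ?_
  filter_upwards [hmem] with τ hτ
  have hτ0 : 0 < τ := lt_of_lt_of_le (by linarith) hτ.1
  rw [Function.comp_apply, ← Real.sqrt_sq (norm_nonneg (_ - _)), norm_sq_eq_integral_hat, hat_sub]
  congr 1
  refine integral_congr_ae ?_
  filter_upwards [hat_Pst_toL2_heat_sq hτ0 (S (t - τ)), hat_Pst_toL2_heat_sq h0 (S (t - τ₀)),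
    Lp.coeFn_sub (hat (Pst (toL2 (heat τ (sq (S (t - τ)))))))
      (hat (Pst (toL2 (heat τ₀ (sq (S (t - τ₀)))))))] with ξ h1 h2 h3
  rw [h3, Pi.sub_apply, h1, h2]
  rfl

theorem intervalIntegrable_duhamel {t : ℝ} (ht : 0 < t) :
    IntervalIntegrable (fun τ => Pst (toL2 (heat τ (sq (S (t - τ)))))) volume 0 t := by
  obtain ⟨M, hM0, hM⟩ := exists_norm_forcing_le hS t
  -- The `L²` norm of `exp (-(τ * rate ξ))` is `(8πτ)^{-3/4}`, a singularity that is integrable at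
  -- `τ = 0`.
  have hrpow : IntervalIntegrable (fun τ : ℝ => M * ((8 * Real.pi) ^ (-(3 / 4) : ℝ) *
      τ ^ (-(3 / 4) : ℝ))) volume 0 t :=
    ((intervalIntegral.intervalIntegrable_rpow' (by norm_num)).const_mul _).const_mul _
  rw [intervalIntegrable_iff_integrableOn_Ioc_of_le ht.le] at hrpow ⊢
  refine Integrable.mono' hrpow ?_ ?_
  · refine ContinuousOn.aestronglyMeasurable (fun τ hτ => ?_) measurableSet_Ioc
    exact (continuousAt_duhamel hS hτ.1).continuousWithinAt
  · refine (ae_restrict_iff' measurableSet_Ioc).2 (Eventually.of_forall fun τ hτ => ?_)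
    have hτ0 := hτ.1
    refine abs_le_of_sq_le_sq' ?_ (by positivity) |>.2
    rw [norm_sq_eq_integral_hat]
    calc ∫ ξ, ‖hat (Pst (toL2 (heat τ (sq (S (t - τ)))))) ξ‖ ^ 2
        ≤ ∫ ξ, M ^ 2 * Real.exp (-(2 * τ * rate ξ)) := by
          refine integral_mono_of_nonneg (Eventually.of_forall fun _ => by positivity)
            ((integrable_exp_rate (by positivity)).const_mul _) ?_
          filter_upwards [hat_Pst_toL2_heat_sq hτ0 (S (t - τ))] with ξ h1
          rw [h1, norm_smul, Real.norm_of_nonneg (by positivity), mul_pow, exp_rate_sq, mul_comm]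
          gcongr
          exact hM _ (by linarith [hτ.2]) (by linarith) ξ
      _ = _ := by
          rw [integral_const_mul, integral_exp_rate (by positivity), mul_pow,
            ← Real.mul_rpow (by positivity) hτ0.le, ← Real.rpow_natCast (_ ^ (_ : ℝ)),
            ← Real.rpow_mul (by positivity)]
          norm_num
          left
          congr 1
          ring

theorem hat_integral_duhamel {t : ℝ} (ht : 0 < t) :
    hat (∫ τ in (0 : ℝ)..t, Pst (toL2 (heat τ (sq (S (t - τ)))))) =ᵐ[volume]
      fun ξ => ∫ s in (0 : ℝ)..t, Real.exp (-((t - s) * rate ξ)) • forcing S s ξ := by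
  obtain ⟨M, hM0, hM⟩ := exists_norm_forcing_le hS t
  have hi := intervalIntegrable_duhamel hS ht
  rw [← hatL_apply, ← ContinuousLinearMap.intervalIntegral_comp_comm _ hi]
  have hi2 : IntervalIntegrable (fun τ => hatL (Pst (toL2 (heat τ (sq (S (t - τ)))))))
      volume 0 t := ⟨hatL.integrable_comp hi.1, hatL.integrable_comp hi.2⟩
  refine (coeFn_intervalIntegral_Lp (h := fun τ ξ => Real.exp (-(τ * rate ξ)) •
    forcing S (t - τ) ξ) (M := M) ht.le hi2 (fun τ hτ => hat_Pst_toL2_heat_sq hτ.1 _)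
    (measurable_duhamel hS t).aestronglyMeasurable fun τ hτ ξ => ?_).trans ?_
  · rw [norm_smul]
    exact (mul_le_of_le_one_left (norm_nonneg _) (norm_exp_rate_le_one hτ.1.le ξ)).trans
      (hM _ (by linarith [hτ.2]) (by linarith [hτ.1]) ξ)
  · refine Eventually.of_forall fun ξ => ?_
    have := intervalIntegral.integral_comp_sub_left (a := 0) (b := t)
      (fun s => Real.exp (-((t - s) * rate ξ)) • forcing S s ξ) t
    simpa using this

end Duhamel

/-! ### Parabolic smoothing -/

section Smoothing

open Filter Topology

/-- The right hand side of the Duhamel formula on the Fourier side, at every frequency. -/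
def profile (S : ℝ → L2Mat) (t : ℝ) (ξ : R3) : CMat3 :=
  Real.exp (-(t * rate ξ)) • hat (S 0) ξ -
    (2 / 3 : ℝ) • ∫ s in (0 : ℝ)..t, Real.exp (-((t - s) * rate ξ)) • forcing S s ξ

variable {S : ℝ → L2Mat} {b : ℝ}

theorem hat_eq_profile (hS : Continuous S) {t : ℝ} (ht : 0 < t)
    (hd : S t = toL2 (heat t (S 0)) -
      (2 / 3 : ℝ) • ∫ τ in (0 : ℝ)..t, Pst (toL2 (heat τ (sq (S (t - τ)))))) :
    hat (S t) =ᵐ[volume] profile S t := by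
  have h : hat (S t) = hat (toL2 (heat t (S 0))) - (2 / 3 : ℝ) •
      hat (∫ τ in (0 : ℝ)..t, Pst (toL2 (heat τ (sq (S (t - τ)))))) := by
    have h1 := congrArg hatL hd
    rwa [map_sub, map_smul] at h1
  rw [h]
  filter_upwards [hat_toL2_heat ht (S 0), hat_integral_duhamel hS ht,
    Lp.coeFn_sub (hat (toL2 (heat t (S 0)))) ((2 / 3 : ℝ) •
      hat (∫ τ in (0 : ℝ)..t, Pst (toL2 (heat τ (sq (S (t - τ))))))),
    Lp.coeFn_smul (2 / 3 : ℝ) (hat (∫ τ in (0 : ℝ)..t, Pst (toL2 (heat τ (sq (S (t - τ)))))))]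
    with ξ h1 h2 h3 h4
  rw [h3, Pi.sub_apply, h4, Pi.smul_apply, h1, h2, profile]

theorem exp_smul_integral (ξ : R3) (a t u : ℝ) :
    ∫ s in a..t, Real.exp (-((u - s) * rate ξ)) • forcing S s ξ =
      Real.exp (-(u * rate ξ)) • ∫ s in a..t, Real.exp (s * rate ξ) • forcing S s ξ := by
  rw [← intervalIntegral.integral_smul]
  congr with s
  rw [show -((u - s) * rate ξ) = -(u * rate ξ) + s * rate ξ by ring, Real.exp_add, mul_smul]

/-- In this integrating factor form `t` enters the integral only through its endpoint, so the
fundamental theorem of calculus differentiates it. -/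
theorem profile_eq (t : ℝ) (ξ : R3) :
    profile S t ξ = Real.exp (-(t * rate ξ)) • (hat (S 0) ξ -
      (2 / 3 : ℝ) • ∫ s in (0 : ℝ)..t, Real.exp (s * rate ξ) • forcing S s ξ) := by
  rw [profile, exp_smul_integral, smul_sub, smul_comm (2 / 3 : ℝ)]

theorem continuous_exp_smul_forcing (hS : Continuous S) (ξ : R3) :
    Continuous fun s => Real.exp (s * rate ξ) • forcing S s ξ := by
  have := continuous_forcing hS ξ
  fun_prop

theorem hasDerivAt_profile (hS : Continuous S) (t : ℝ) (ξ : R3) :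
    HasDerivAt (fun t => profile S t ξ)
      (-(rate ξ) • profile S t ξ - (2 / 3 : ℝ) • forcing S t ξ) t := by
  have h1 : HasDerivAt (fun t => Real.exp (-(t * rate ξ)))
      (Real.exp (-(t * rate ξ)) * -(rate ξ)) t := by
    have := ((hasDerivAt_id t).mul_const (rate ξ)).fun_neg.exp
    simpa using this
  have hc := continuous_exp_smul_forcing hS ξ
  have h2 : HasDerivAt (fun t => ∫ s in (0 : ℝ)..t, Real.exp (s * rate ξ) • forcing S s ξ)
      (Real.exp (t * rate ξ) • forcing S t ξ) t := hc.integral_hasStrictDerivAt 0 t |>.hasDerivAt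
  have h3 := h1.fun_smul ((h2.const_smul (2 / 3 : ℝ)).const_sub (hat (S 0) ξ))
  simp only [profile_eq]
  refine h3.congr_deriv ?_
  rw [smul_neg, smul_comm (2 / 3 : ℝ), smul_smul, ← Real.exp_add, neg_add_cancel, Real.exp_zero,
    one_smul, smul_smul]
  rw [mul_comm (Real.exp _)]
  abel

/-- Restarting at a positive time uses forcing bounds only after `a` and puts a Gaussian factor on
the new initial value. -/
theorem profile_restart (hS : Continuous S) (a t : ℝ) (ξ : R3) :
    profile S t ξ = Real.exp (-((t - a) * rate ξ)) • profile S a ξ -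
      (2 / 3 : ℝ) • ∫ s in a..t, Real.exp (-((t - s) * rate ξ)) • forcing S s ξ := by
  have hc := continuous_exp_smul_forcing hS ξ
  rw [profile_eq t, profile_eq a, exp_smul_integral,
    ← intervalIntegral.integral_add_adjacent_intervals (hc.intervalIntegrable 0 a)
      (hc.intervalIntegrable a t), smul_smul, ← Real.exp_add,
    show -((t - a) * rate ξ) + -(a * rate ξ) = -(t * rate ξ) by ring,
    smul_comm (2 / 3 : ℝ) (Real.exp (-(t * rate ξ))), ← smul_sub, smul_add, sub_sub]

theorem norm_sq_le_rate (ξ : R3) : ‖ξ‖ ^ 2 ≤ rate ξ := by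
  rw [rate, mul_pow]
  have : (1 : ℝ) ≤ (2 * Real.pi) ^ 2 := by nlinarith [Real.pi_gt_three]
  nlinarith [sq_nonneg ‖ξ‖]

/-- The integral itself is at most `t - a`, and `r` times it equals `1 - exp (-((t - a) * r)) ≤ 1`.
With `r = rate ξ` this is the gain of two powers of `|ξ|`. -/
theorem integral_exp_le {r a t : ℝ} (hr : 0 ≤ r) (hat : a ≤ t) :
    (1 + r) * ∫ s in a..t, Real.exp (-((t - s) * r)) ≤ 1 + (t - a) := by
  have hc : Continuous fun s => Real.exp (-((t - s) * r)) := by fun_prop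
  have h1 : ∫ s in a..t, Real.exp (-((t - s) * r)) ≤ t - a := by
    have : ∫ s in a..t, Real.exp (-((t - s) * r)) ≤ ∫ _ in a..t, (1 : ℝ) := by
      refine intervalIntegral.integral_mono_on hat (hc.intervalIntegrable _ _)
        (continuous_const.intervalIntegrable _ _) fun s hs => ?_
      rw [Real.exp_le_one_iff]
      have := mul_nonneg (sub_nonneg.2 hs.2) hr
      linarith
    simpa using this
  have h2 : ∫ s in a..t, r * Real.exp (-((t - s) * r)) =
      Real.exp (-((t - t) * r)) - Real.exp (-((t - a) * r)) := by
    refine intervalIntegral.integral_eq_sub_of_hasDerivAt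
      (f := fun s => Real.exp (-((t - s) * r))) (fun s _ => ?_)
      ((hc.const_mul r).intervalIntegrable _ _)
    have := ((((hasDerivAt_id s).const_sub t).mul_const r).fun_neg).exp
    refine this.congr_deriv ?_
    simp [mul_comm]
  rw [intervalIntegral.integral_const_mul] at h2
  have h3 := Real.exp_pos (-((t - a) * r))
  simp only [sub_self, zero_mul, neg_zero, Real.exp_zero] at h2
  linarith

theorem integral_exp_rate_le {a t : ℝ} (hat : a ≤ t) (ξ : R3) :
    ∫ s in a..t, Real.exp (-((t - s) * rate ξ)) ≤
      2 * (1 + (t - a)) * (1 + ‖ξ‖) ^ (-2 : ℝ) := by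
  have h := integral_exp_le (rate_nonneg ξ) hat
  have h0 : 0 ≤ ∫ s in a..t, Real.exp (-((t - s) * rate ξ)) :=
    intervalIntegral.integral_nonneg hat fun _ _ => by positivity
  have h1 : (1 + ‖ξ‖) ^ 2 ≤ 2 * (1 + rate ξ) := by
    nlinarith [norm_sq_le_rate ξ, sq_nonneg (‖ξ‖ - 1)]
  rw [Real.rpow_neg (by positivity), Real.rpow_two, ← div_eq_mul_inv, le_div_iff₀ (by positivity)]
  nlinarith

/-- Use `(1 + x)^ρ ≤ exp (ρx)` and `rate ξ ≥ |ξ|²`, then complete the square: `ρx - cx² ≤ ρ²/(4c)`.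
-/
theorem weight_mul_exp_le {ρ c : ℝ} (hρ : 0 ≤ ρ) (hc : 0 < c) (ξ : R3) :
    (1 + ‖ξ‖) ^ ρ * Real.exp (-(c * rate ξ)) ≤ Real.exp (ρ ^ 2 / (4 * c)) := by
  have h1 : (1 + ‖ξ‖) ^ ρ ≤ Real.exp (ρ * ‖ξ‖) := by
    rw [mul_comm, Real.exp_mul]
    refine Real.rpow_le_rpow (by positivity) ?_ hρ
    linarith [Real.add_one_le_exp ‖ξ‖]
  refine (mul_le_mul_of_nonneg_right h1 (by positivity)).trans ?_
  rw [← Real.exp_add, Real.exp_le_exp, le_div_iff₀ (by positivity)]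
  have := mul_le_mul_of_nonneg_left (norm_sq_le_rate ξ) hc.le
  nlinarith [sq_nonneg (ρ - 2 * c * ‖ξ‖)]

/-- The squared weight decays with exponent 16/5, which exceeds the dimension 3. -/
theorem memLp_weight : MemLp (fun ξ : R3 => (1 + ‖ξ‖) ^ (-(8 / 5) : ℝ)) 2 volume := by
  have hm : Measurable fun ξ : R3 => (1 + ‖ξ‖) ^ (-(8 / 5) : ℝ) := by fun_prop
  refine (memLp_two_iff_integrable_sq hm.aestronglyMeasurable).2 ?_
  have h := integrable_one_add_norm (E := R3) (μ := volume) (r := 16 / 5) (by simp; norm_num)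
  refine h.congr (Eventually.of_forall fun ξ => ?_)
  simp only
  rw [← Real.rpow_natCast, ← Real.rpow_mul (by positivity)]
  norm_num

/-- On every `[a, b]` with `a > 0` the profile is dominated by one function that is square
integrable with the weight `(1 + |ξ|)^ρ`. -/
def HasProfileBound (S : ℝ → L2Mat) (b ρ : ℝ) : Prop :=
  ∀ a, 0 < a → a ≤ b → ∃ g : R3 → ℝ, MemLp (fun ξ => (1 + ‖ξ‖) ^ ρ * g ξ) 2 volume ∧
    ∀ t ∈ Set.Icc a b, ∀ ξ, ‖profile S t ξ‖ ≤ g ξ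

/-- On every `[a, b]` with `a > 0` the forcing decays like `(1 + |ξ|)^{-ρ}`. -/
def HasForcingBound (S : ℝ → L2Mat) (b ρ : ℝ) : Prop :=
  ∀ a, 0 < a → a ≤ b → ∃ C : ℝ, 0 ≤ C ∧
    ∀ t ∈ Set.Icc a b, ∀ ξ, ‖forcing S t ξ‖ ≤ C * (1 + ‖ξ‖) ^ (-ρ)

theorem hasForcingBound_zero (hS : Continuous S) : HasForcingBound S b 0 := by
  intro a ha _
  obtain ⟨M, hM0, hM⟩ := exists_norm_forcing_le hS b
  exact ⟨M, hM0, fun t ht ξ => by simpa using hM t (ha.le.trans ht.1) ht.2 ξ⟩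

theorem HasProfileBound.forcing {ρ : ℝ} (hρ : 0 ≤ ρ)
    (hp : ∀ t, 0 < t → t ≤ b → hat (S t) =ᵐ[volume] profile S t) (h : HasProfileBound S b ρ) :
    HasForcingBound S b ρ := by
  intro a ha hab
  obtain ⟨g, hg, hb⟩ := h a ha hab
  refine ⟨3 * ∫ η : R3, ((1 + ‖η‖) ^ ρ * g η) ^ 2, mul_nonneg (by norm_num)
    (integral_nonneg fun _ => sq_nonneg _), fun t ht ξ => ?_⟩
  have h1 := integral_weight_nl_le hρ (S t) (g := g) (by
    filter_upwards [hp t (ha.trans_le ht.1) ht.2] with η hη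
    rw [hη]
    exact hb t ht η) hg ξ
  refine (norm_symbol_le _ _).trans ?_
  rw [Real.rpow_neg (by positivity), ← div_eq_mul_inv, le_div_iff₀ (by positivity), mul_comm]
  exact h1

theorem norm_integral_forcing_le {ρ C a t : ℝ} (hat : a ≤ t) (ξ : R3)
    (hC : 0 ≤ C) (h : ∀ s ∈ Set.Icc a t, ‖forcing S s ξ‖ ≤ C * (1 + ‖ξ‖) ^ (-ρ)) :
    ‖∫ s in a..t, Real.exp (-((t - s) * rate ξ)) • forcing S s ξ‖ ≤
      C * (2 * (1 + (t - a))) * (1 + ‖ξ‖) ^ (-ρ - 2) := by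
  calc ‖∫ s in a..t, Real.exp (-((t - s) * rate ξ)) • forcing S s ξ‖
      ≤ ∫ s in a..t, (C * (1 + ‖ξ‖) ^ (-ρ)) * Real.exp (-((t - s) * rate ξ)) := by
        refine intervalIntegral.norm_integral_le_of_norm_le hat (Eventually.of_forall
          fun s hs => ?_) (Continuous.intervalIntegrable (by fun_prop) _ _)
        rw [norm_smul, Real.norm_of_nonneg (by positivity), mul_comm]
        gcongr
        exact h s ⟨hs.1.le, hs.2⟩
    _ ≤ (C * (1 + ‖ξ‖) ^ (-ρ)) * (2 * (1 + (t - a)) * (1 + ‖ξ‖) ^ (-2 : ℝ)) := by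
        rw [intervalIntegral.integral_const_mul]
        gcongr
        exact integral_exp_rate_le hat ξ
    _ = _ := by
        rw [show -ρ - 2 = -ρ + -2 by ring, Real.rpow_add (by positivity)]
        ring

/-- Restart at `a / 2`. For `t ≥ a` the linear part carries the factor `exp (-(a / 2 * rate ξ))`,
which absorbs any weight; the integral is `O((1 + |ξ|)^{-ρ-2})`, and multiplying by the weight of
exponent `ρ + 2/5` leaves the exponent `-8/5` of `memLp_weight`. -/
theorem HasForcingBound.profile (hS : Continuous S) {ρ : ℝ} (hρ : 0 ≤ ρ)
    (hp : ∀ t, 0 < t → t ≤ b → hat (S t) =ᵐ[volume] profile S t) (h : HasForcingBound S b ρ) :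
    HasProfileBound S b (ρ + 2 / 5) := by
  intro a ha hab
  obtain ⟨C, hC0, hC⟩ := h (a / 2) (by linarith) (by linarith)
  set K : ℝ := 2 / 3 * (C * (2 * (1 + b)))
  refine ⟨fun ξ => Real.exp (-(a / 2 * rate ξ)) * ‖StrainModel.profile S (a / 2) ξ‖ +
    K * (1 + ‖ξ‖) ^ (-ρ - 2), ?_, fun t ht ξ => ?_⟩
  · have hpm : MemLp (fun ξ => ‖StrainModel.profile S (a / 2) ξ‖) 2 volume :=
      ((Lp.memLp (hat (S (a / 2)))).ae_eq (hp _ (by linarith) (by linarith))).norm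
    have h1 : MemLp (fun ξ : R3 => (1 + ‖ξ‖) ^ (ρ + 2 / 5) * (Real.exp (-(a / 2 * rate ξ)) *
        ‖StrainModel.profile S (a / 2) ξ‖)) 2 volume := by
      have hm : Measurable fun ξ : R3 => (1 + ‖ξ‖) ^ (ρ + 2 / 5) * Real.exp (-(a / 2 * rate ξ)) :=
        Measurable.mul (by fun_prop) (Continuous.measurable (by fun_prop))
      refine MemLp.of_le_mul (c := Real.exp ((ρ + 2 / 5) ^ 2 / (4 * (a / 2)))) hpm ?_
        (Eventually.of_forall fun ξ => ?_)
      · simp only [← mul_assoc]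
        exact hm.aestronglyMeasurable.mul hpm.1
      · rw [← mul_assoc, norm_mul, Real.norm_of_nonneg (by positivity)]
        gcongr
        exact weight_mul_exp_le (by linarith) (by linarith) ξ
    have h2 : MemLp (fun ξ : R3 => (1 + ‖ξ‖) ^ (ρ + 2 / 5) * (K * (1 + ‖ξ‖) ^ (-ρ - 2)))
        2 volume := by
      refine (memLp_weight.const_mul K).ae_eq (Eventually.of_forall fun ξ => ?_)
      simp only
      rw [mul_left_comm, ← Real.rpow_add (by positivity)]
      congr 2
      ring
    simp only [mul_add]
    exact h1.add h2
  · rw [profile_restart hS (a / 2) t]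
    refine (norm_sub_le _ _).trans (add_le_add ?_ ?_)
    · rw [norm_smul, Real.norm_of_nonneg (by positivity)]
      gcongr
      · exact rate_nonneg ξ
      · linarith [ht.1]
    · rw [norm_smul, Real.norm_of_nonneg (by norm_num), mul_assoc]
      gcongr
      refine (norm_integral_forcing_le (by linarith [ht.1]) ξ hC0
        fun s hs => hC s ⟨hs.1, hs.2.trans ht.2⟩ ξ).trans ?_
      gcongr
      linarith [ht.2]

theorem hasProfileBound (hS : Continuous S)
    (hp : ∀ t, 0 < t → t ≤ b → hat (S t) =ᵐ[volume] profile S t) :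
    HasProfileBound S b (8 / 5) := by
  -- The exponent runs through 2/5, 4/5, 6/5, 8/5; the last is the first one above 3/2.
  have h1 := (hasForcingBound_zero hS).profile hS le_rfl hp
  have h2 := (h1.forcing (by norm_num) hp).profile hS (by norm_num) hp
  have h3 := (h2.forcing (by norm_num) hp).profile hS (by norm_num) hp
  have h4 := (h3.forcing (by norm_num) hp).profile hS (by norm_num) hp
  norm_num at h4
  exact h4

end Smoothing

/-! ### The energy identity -/

section Energy

open Filter Topology

/-- The exponent 8/5 serves twice: above 3/2 it gives `g ∈ L¹` by Cauchy–Schwarz against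
`memLp_weight`, and above 1 it controls `|ξ| g` in `L²`. -/
theorem integrable_of_memLp_weight {g : R3 → ℝ}
    (hg : MemLp (fun ξ : R3 => (1 + ‖ξ‖) ^ (8 / 5 : ℝ) * g ξ) 2 volume) :
    Integrable g ∧ Integrable fun ξ => rate ξ * g ξ ^ 2 := by
  have he : ∀ ξ : R3, (1 + ‖ξ‖) ^ (-(8 / 5) : ℝ) * ((1 + ‖ξ‖) ^ (8 / 5 : ℝ) * g ξ) = g ξ := by
    intro ξ
    rw [← mul_assoc, ← Real.rpow_add (by positivity)]
    simp
  have h1 : Integrable g :=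
    (memLp_weight.integrable_mul hg).congr (Eventually.of_forall he)
  refine ⟨h1, ((hg.integrable_sq).const_mul ((2 * Real.pi) ^ 2)).mono'
    (continuous_rate.aestronglyMeasurable.mul (h1.1.pow 2)) (Eventually.of_forall fun ξ => ?_)⟩
  rw [norm_mul, Real.norm_of_nonneg (rate_nonneg ξ), Real.norm_of_nonneg (sq_nonneg _), rate,
    mul_pow, mul_pow _ (g ξ), mul_assoc]
  gcongr
  calc ‖ξ‖ ≤ 1 + ‖ξ‖ := by linarith
    _ ≤ (1 + ‖ξ‖) ^ (8 / 5 : ℝ) := by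
      refine Real.self_le_rpow_of_one_le ?_ (by norm_num)
      linarith [norm_nonneg ξ]

/-- A field with integrable Fourier transform is bounded, hence has a square integrable square. -/
theorem memLp_sq_of_integrable_hat {Q : L2Mat} (h : Integrable (hat Q)) :
    MemLp (sq Q) 2 volume := by
  have hb : ∀ᵐ x : R3, ‖Q x‖ ≤ ∫ ξ, ‖hat Q ξ‖ := by
    filter_upwards [(isFourierPair_hat Q).ae_eq_fourierInv h] with x hx
    rw [← norm_complexify, hx, Real.fourierInv_eq_fourier_neg]
    exact IsFourierPair.norm_fourier_le _ _
  refine (Lp.memLp Q).of_le_mul (c := ∫ ξ, ‖hat Q ξ‖) (aestronglyMeasurable_sq Q) ?_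
  filter_upwards [hb] with x hx
  refine (norm_matSq_le _).trans ?_
  rw [pow_two]
  gcongr

theorem ae_trace_eq_inner {Q : L2Mat} (hQ : Q ∈ L2st) :
    (fun x => (toMatrix (Q x) ^ 3).trace) =ᵐ[volume] fun x => inner ℝ (sq Q x) (Q x) := by
  filter_upwards [ae_symm_of_mem_L2st hQ] with x hx
  exact trace_pow_three_eq_inner hx.1

theorem ae_trace_eq_det {Q : L2Mat} (hQ : Q ∈ L2st) :
    (fun x => (toMatrix (Q x) ^ 3).trace) =ᵐ[volume] fun x => 3 * (toMatrix (Q x)).det := by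
  filter_upwards [ae_symm_of_mem_L2st hQ] with x hx
  exact trace_pow_three_eq_det hx.2

theorem integrable_trace {Q : L2Mat} (hQ : Q ∈ L2st) (h : Integrable (hat Q)) :
    Integrable fun x => (toMatrix (Q x) ^ 3).trace := by
  have h2 := memLp_sq_of_integrable_hat h
  refine Integrable.congr ?_ (ae_trace_eq_inner hQ).symm
  refine (h2.norm.integrable_mul (Lp.memLp Q).norm).mono'
    (h2.1.inner (Lp.aestronglyMeasurable Q)) (Eventually.of_forall fun x => ?_)
  exact norm_inner_le_norm _ _

theorem integrable_det {Q : L2Mat} (hQ : Q ∈ L2st) (h : Integrable (hat Q)) :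
    Integrable fun x => (toMatrix (Q x)).det := by
  refine ((integrable_trace hQ h).const_mul (1 / 3)).congr ?_
  filter_upwards [ae_trace_eq_det hQ] with x hx
  rw [hx]
  ring

theorem integral_trace_eq_integral_det {Q : L2Mat} (hQ : Q ∈ L2st) :
    ∫ x, (toMatrix (Q x) ^ 3).trace = 3 * ∫ x, (toMatrix (Q x)).det := by
  rw [integral_congr_ae (ae_trace_eq_det hQ), integral_const_mul]

/-- Plancherel's theorem for the nonlinear term. -/
theorem integral_re_inner_symbol_nl {Q : L2Mat} (hQ : Q ∈ L2st) (h : Integrable (hat Q)) :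
    ∫ ξ, (inner ℂ (hat Q ξ) (symbol ξ (nl Q ξ))).re = ∫ x, (toMatrix (Q x) ^ 3).trace := by
  have h2 := memLp_sq_of_integrable_hat h
  have hp : IsFourierPair (fun x => complexify (sq Q x)) (nl Q) :=
    IsFourierPair.of_integrable (complexify.integrable_comp (integrable_sq Q))
      (complexify.comp_memLp' h2)
  have hi : Integrable fun ξ => inner ℂ (hat Q ξ) (nl Q ξ) :=
    ((Lp.memLp (hat Q)).norm.integrable_mul hp.2.norm).mono'
      ((Lp.aestronglyMeasurable _).inner hp.2.1)
      (Eventually.of_forall fun ξ => norm_inner_le_norm _ _)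
  have h1 := ofReal_integral_inner (isFourierPair_hat Q) hp
  have h3 : ∫ ξ, (inner ℂ (hat Q ξ) (symbol ξ (nl Q ξ))).re =
      ∫ ξ, (inner ℂ (hat Q ξ) (nl Q ξ)).re := by
    refine integral_congr_ae ?_
    filter_upwards [(mem_L2st_iff_isStrainAt Q).1 hQ, ae_ne_zero] with ξ h4 h5
    -- The projection moves onto `hat Q`, which is already a strain.
    rw [← inner_symbol_left, symbol_eq_self h5 h4]
  rw [h3, integral_congr_ae (ae_trace_eq_inner hQ)]
  have h6 := integral_re hi
  simp only [RCLike.re_eq_complex_re] at h6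
  rw [h6, ← h1, Complex.ofReal_re]
  simp only [real_inner_comm]

variable {S : ℝ → L2Mat} {b : ℝ}

theorem hasDerivAt_norm_sq_profile (hS : Continuous S) (t : ℝ) (ξ : R3) :
    HasDerivAt (fun s => ‖profile S s ξ‖ ^ 2) (-2 * (rate ξ * ‖profile S t ξ‖ ^ 2) -
      4 / 3 * (inner ℂ (profile S t ξ) (forcing S t ξ)).re) t := by
  have h := hasDerivAt_profile hS t ξ
  have h1 := Complex.reCLM.hasFDerivAt.comp_hasDerivAt t (h.inner ℂ h)
  have e : (Complex.reCLM ∘ fun s => inner ℂ (profile S s ξ) (profile S s ξ)) =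
      fun s => ‖profile S s ξ‖ ^ 2 := by
    ext s
    exact inner_self_eq_norm_sq (𝕜 := ℂ) (profile S s ξ)
  rw [e] at h1
  refine h1.congr_deriv ?_
  have h2 : (inner ℂ (profile S t ξ) (profile S t ξ)).re = ‖profile S t ξ‖ ^ 2 :=
    inner_self_eq_norm_sq (𝕜 := ℂ) (profile S t ξ)
  have h3 : (inner ℂ (forcing S t ξ) (profile S t ξ)).re =
      (inner ℂ (profile S t ξ) (forcing S t ξ)).re := by
    rw [← inner_conj_symm, Complex.conj_re]
  rw [Complex.reCLM_apply, ← Complex.coe_smul, ← Complex.coe_smul]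
  simp only [inner_sub_left, inner_sub_right, inner_smul_left, inner_smul_right,
    Complex.conj_ofReal, Complex.add_re, Complex.sub_re, Complex.re_ofReal_mul, h2, h3]
  ring

/-- Differentiation under the integral of `‖profile S s ξ‖²`, dominated for `s ∈ [t/2, b]` by `2
rate g² + (4/3) M g`, where `g` comes from `hasProfileBound` and `M` bounds the forcing. The
integrability of `hat (S t)` is recorded because the cubic integrals need it as well. -/
theorem energy_identity (hS : Continuous S) (hmem : ∀ s, S s ∈ L2st)
    (hd : ∀ t, 0 < t → t ≤ b → S t = toL2 (heat t (S 0)) -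
      (2 / 3 : ℝ) • ∫ τ in (0 : ℝ)..t, Pst (toL2 (heat τ (sq (S (t - τ))))))
    {t : ℝ} (ht : 0 < t) (htb : t < b) :
    Integrable (hat (S t)) ∧ Integrable (hdot1Density (S t)) ∧
    HasDerivAt (fun s => ‖S s‖ ^ 2) (-2 * hdot1NormSq (S t) -
      4 / 3 * ∫ x, (toMatrix (S t x) ^ 3).trace) t := by
  have hp : ∀ t, 0 < t → t ≤ b → hat (S t) =ᵐ[volume] profile S t := fun t h0 h1 =>
    hat_eq_profile hS h0 (hd t h0 h1)
  obtain ⟨M, hM0, hM⟩ := exists_norm_forcing_le hS b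
  obtain ⟨g, hg, hgb⟩ := hasProfileBound hS hp (t / 2) (by linarith) (by linarith)
  obtain ⟨hg1, hg2⟩ := integrable_of_memLp_weight hg
  have htm : t ∈ Set.Icc (t / 2) b := ⟨by linarith, htb.le⟩
  have hpt := hp t ht htb.le
  have hpm : AEStronglyMeasurable (profile S t) volume :=
    (Lp.aestronglyMeasurable (hat (S t))).congr hpt
  have hint : Integrable (hat (S t)) :=
    (hg1.mono' hpm (Eventually.of_forall (hgb t htm))).congr hpt.symm
  have hnn : ∀ s ∈ Set.Icc (t / 2) b, ∀ ξ, rate ξ * ‖profile S s ξ‖ ^ 2 ≤ rate ξ * g ξ ^ 2 :=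
    fun s hs ξ => by
      have := hgb s hs ξ
      have := rate_nonneg ξ
      gcongr
  have hrate : Integrable fun ξ => rate ξ * ‖profile S t ξ‖ ^ 2 := by
    refine hg2.mono' (continuous_rate.aestronglyMeasurable.mul (hpm.norm.pow 2))
      (Eventually.of_forall fun ξ => ?_)
    rw [Real.norm_of_nonneg (mul_nonneg (rate_nonneg ξ) (sq_nonneg _))]
    exact hnn t htm ξ
  have hdens : (fun ξ => rate ξ * ‖profile S t ξ‖ ^ 2) =ᵐ[volume] hdot1Density (S t) := by
    filter_upwards [hpt] with ξ hξ
    rw [hdot1Density, hξ, rate]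
  refine ⟨hint, hrate.congr hdens, ?_⟩
  have hnear : ∀ᶠ s in 𝓝 t, s ∈ Set.Icc (t / 2) b := Icc_mem_nhds (by linarith) htb
  have hfm : AEStronglyMeasurable (fun ξ => forcing S t ξ) volume :=
    ((measurable_forcing hS).comp measurable_prodMk_left).aestronglyMeasurable
  have hinner : ∀ s ∈ Set.Icc (t / 2) b, ∀ ξ,
      ‖(inner ℂ (profile S s ξ) (forcing S s ξ)).re‖ ≤ M * g ξ := by
    intro s hs ξ
    have h1 := hgb s hs ξ
    refine (Complex.abs_re_le_norm _).trans ((norm_inner_le_norm _ _).trans ?_)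
    rw [mul_comm M]
    exact mul_le_mul h1 (hM s (by linarith [hs.1]) hs.2 ξ) (norm_nonneg _)
      ((norm_nonneg _).trans h1)
  have hinm : AEStronglyMeasurable (fun ξ => (inner ℂ (profile S t ξ) (forcing S t ξ)).re)
      volume := Complex.continuous_re.comp_aestronglyMeasurable (hpm.inner hfm)
  have hini : Integrable fun ξ => (inner ℂ (profile S t ξ) (forcing S t ξ)).re :=
    (hg1.const_mul M).mono' hinm (Eventually.of_forall (hinner t htm))
  have hderiv := (hasDerivAt_integral_of_dominated_loc_of_deriv_le (μ := volume)
    (F := fun s ξ => ‖profile S s ξ‖ ^ 2)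
    (F' := fun s ξ => -2 * (rate ξ * ‖profile S s ξ‖ ^ 2) -
      4 / 3 * (inner ℂ (profile S s ξ) (forcing S s ξ)).re)
    (bound := fun ξ => 2 * (rate ξ * g ξ ^ 2) + 4 / 3 * (M * g ξ)) (x₀ := t) hnear
    (hnear.mono fun s hs => (((Lp.aestronglyMeasurable (hat (S s))).congr
      (hp s (by linarith [hs.1]) hs.2)).norm.pow 2))
    (((memLp_two_iff_integrable_sq_norm (Lp.aestronglyMeasurable (hat (S t)))).1
      (Lp.memLp (hat (S t)))).congr (hpt.mono fun ξ hξ => by simp only [hξ]))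
    ((((hrate.1.const_mul (-2))).sub (hinm.const_mul (4 / 3))))
    (Eventually.of_forall fun ξ s hs => by
      have h1 := hnn s hs ξ
      have h2 := hinner s hs ξ
      have h3 : 0 ≤ rate ξ * ‖profile S s ξ‖ ^ 2 := mul_nonneg (rate_nonneg ξ) (sq_nonneg _)
      rw [Real.norm_eq_abs, abs_le] at h2 ⊢
      constructor <;> linarith)
    ((hg2.const_mul 2).add ((hg1.const_mul M).const_mul (4 / 3)))
    (Eventually.of_forall fun ξ s _ => hasDerivAt_norm_sq_profile hS s ξ)).2
  have hval : ∫ ξ, (-2 * (rate ξ * ‖profile S t ξ‖ ^ 2) -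
      4 / 3 * (inner ℂ (profile S t ξ) (forcing S t ξ)).re) =
      -2 * hdot1NormSq (S t) - 4 / 3 * ∫ x, (toMatrix (S t x) ^ 3).trace := by
    rw [integral_sub (hrate.const_mul _) (hini.const_mul _), integral_const_mul,
      integral_const_mul, integral_congr_ae hdens, hdot1NormSq,
      ← integral_re_inner_symbol_nl (hmem t) hint]
    congr 2
    refine integral_congr_ae ?_
    filter_upwards [hpt] with ξ hξ
    rw [hξ, forcing]
  rw [hval] at hderiv
  refine hderiv.congr_of_eventuallyEq (hnear.mono fun s hs => ?_)
  simp only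
  rw [norm_sq_eq_integral_hat]
  refine integral_congr_ae ?_
  filter_upwards [hp s (by linarith [hs.1]) hs.2] with ξ hξ
  rw [hξ]

end Energy

end StrainModel

end

/-! ### Reduction to a compact time interval and conclusion -/

theorem mainTheorem6 (T : EReal) (S : ℝ → StrainModel.L2Mat)
    (hS : StrainModel.IsMildSolution T S) (t : ℝ) (ht : 0 < t) (htT : (t : EReal) < T) :
    Integrable (StrainModel.hdot1Density (S t)) volume ∧
    Integrable (fun x => (StrainModel.toMatrix (S t x) ^ 3).trace) volume ∧
    Integrable (fun x => (StrainModel.toMatrix (S t x)).det) volume ∧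
    HasDerivAt (fun s => ‖S s‖ ^ 2)
      (-2 * StrainModel.hdot1NormSq (S t)
        - 4 / 3 * ∫ x, (StrainModel.toMatrix (S t x) ^ 3).trace) t ∧
    -2 * StrainModel.hdot1NormSq (S t)
        - 4 / 3 * ∫ x, (StrainModel.toMatrix (S t x) ^ 3).trace
      = -2 * StrainModel.hdot1NormSq (S t)
        - 4 * ∫ x, (StrainModel.toMatrix (S t x)).det := by
  obtain ⟨b, htb', hbT⟩ := EReal.lt_iff_exists_real_btwn.1 htT
  have htb : t < b := by exact_mod_cast htb'
  have hb : 0 ≤ b := (ht.trans htb).le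
  have hlt : ∀ s, s ≤ b → (s : EReal) < T := fun s hs =>
    lt_of_le_of_lt (by exact_mod_cast hs) hbT
  -- Freezing `S` at its endpoint values outside `[0, b]` gives a function continuous on the whole
  -- line. The Duhamel formula at times in `(0, b]` only involves times in `[0, b]`, so it is
  -- unchanged, and `t < b` makes the two functions agree near `t`.
  let R : ℝ → StrainModel.L2Mat := fun s => S (Set.projIcc 0 b hb s)
  have hR : ∀ s, 0 ≤ s → s ≤ b → R s = S s := fun s h0 h1 => by
    simp only [R, Set.projIcc_of_mem hb ⟨h0, h1⟩]
  have hRc : Continuous R := by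
    have h1 : ContinuousOn S (Set.Icc 0 b) := hS.continuousOn.mono fun s hs => ⟨hs.1, hlt s hs.2⟩
    exact h1.domRestrict.comp continuous_projIcc
  have hRm : ∀ s, R s ∈ StrainModel.L2st := fun s =>
    hS.mem _ (Set.projIcc 0 b hb s).2.1 (hlt _ (Set.projIcc 0 b hb s).2.2)
  have hRd : ∀ t, 0 < t → t ≤ b → R t = StrainModel.toL2 (StrainModel.heat t (R 0)) -
      (2 / 3 : ℝ) • ∫ τ in (0 : ℝ)..t, StrainModel.Pst (StrainModel.toL2
        (StrainModel.heat τ (StrainModel.sq (R (t - τ))))) := by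
    intro t h0 h1
    rw [hR t h0.le h1, hR 0 le_rfl hb, hS.duhamel t h0 (hlt t h1)]
    congr 2
    refine intervalIntegral.integral_congr fun τ hτ => ?_
    rw [Set.uIcc_of_le h0.le] at hτ
    rw [hR (t - τ) (by linarith [hτ.2]) (by linarith [hτ.1])]
  obtain ⟨h1, h2, h3⟩ := StrainModel.energy_identity hRc hRm hRd ht htb
  have hRt : R t = S t := hR t ht.le htb.le
  have hmem := hRm t
  rw [hRt] at h1 h2 h3 hmem
  refine ⟨h2, StrainModel.integrable_trace hmem h1, StrainModel.integrable_det hmem h1, ?_, ?_⟩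
  · refine h3.congr_of_eventuallyEq ?_
    filter_upwards [Icc_mem_nhds ht htb] with s hs
    rw [hR s hs.1 hs.2]
  · rw [StrainModel.integral_trace_eq_integral_det hmem]
    ring
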